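/- Let $d\ge 2$ be an integer and $c>0$ a real number. Let $Y_d(n,p)$ denote the random simplicial complex on $n$ vertices that contains all nonempty sets of at most $d$ vertices as faces (full $(d-1)$-skeleton), in which each set of $d+1$ vertices is a ($d$-dimensional) face independently with probability $p$, and which has no other faces. An elementary $d$-collapse of a complex $Y$ removes from $Y$ a $(d-1)$-face $\tau$ that is contained in exactly one $d$-face $\sigma$ of $Y$, together with $\sigma$. Let $R_\infty(Y)$ denote a complex that is obtained from $Y$ by performing elementary $d$-collapses, in any order and with arbitrary choices, until none is possible, and let $f_d(\cdot)$ denote the number of $d$-faces. A complex is called a $d$-gravel if its set of $d$-faces is the union of the sets of $d$-faces of a (possibly empty) family of pairwise vertex-disjoint boundaries $\partial\Delta_{d+1}$ of $(d+1)$-simplices, where the $d$-faces of $\partial\Delta_{d+1}$ are all $d+2$ subsets of size $d+1$ of a set of $d+2$ vertices. Then there is $\alpha=\alpha(d,c)>0$ such that, with probability tending to $1$ as $n\to\infty$, the complex $Y=Y_d\left(n,\frac cn\right)$ satisfies the following for every possible outcome of $R_\infty(Y)$: either $R_\infty(Y)$ is a $d$-gravel or $f_d(R_\infty(Y))>\alpha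 n^d$. -/

import Mathlib

open Filter Topology ProbabilityTheory

namespace RandomComplex

variable {V : Type*}

/-- The `d`-dimensional faces of a complex, i.e. its faces with `d + 1` vertices. -/
def dFaces (d : ℕ) (Y : PreAbstractSimplicialComplex V) : Set (Finset V) :=
  {σ | σ ∈ Y.faces ∧ σ.card = d + 1}

/-- The face number `f_d(Y)`. It is only used for a finite vertex set. -/
noncomputable def faceNumber (d : ℕ) (Y : PreAbstractSimplicialComplex V) : ℕ :=
  (dFaces d Y).ncard

/-- `τ` is a free `(d-1)`-face of `Y` and `σ` is the only `d`-face of `Y` that contains it. -/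
def IsFreePair (d : ℕ) (Y : PreAbstractSimplicialComplex V) (τ σ : Finset V) : Prop :=
  (τ ∈ Y.faces ∧ τ.card = d) ∧ (σ ∈ dFaces d Y ∧ τ ⊆ σ) ∧
    ∀ σ' ∈ dFaces d Y, τ ⊆ σ' → σ' = σ

/-- `Y'` is obtained from `Y` by one elementary `d`-collapse: a free `(d-1)`-face and
the unique `d`-face that contains it are removed. -/
def ElementaryCollapse (d : ℕ) (Y Y' : PreAbstractSimplicialComplex V) : Prop :=
  ∃ τ σ, IsFreePair d Y τ σ ∧ Y'.faces = Y.faces \ {τ, σ}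

/-- `R` is a possible value of `R_∞(Y)`: it is obtained from `Y` by elementary `d`-collapses, and
none is possible any more. (The choices made on the way may affect the `(d-1)`-faces of `R`.) -/
def IsFullCollapse (d : ℕ) (Y R : PreAbstractSimplicialComplex V) : Prop :=
  Relation.ReflTransGen (ElementaryCollapse d) Y R ∧ ∀ τ σ, ¬ IsFreePair d R τ σ

/-- `Y` is a `d`-gravel: its `d`-faces are exactly the facets of the members of a (possibly empty)
family of pairwise vertex-disjoint `(d+1)`-simplices. -/
def IsGravel (d : ℕ) (Y : PreAbstractSimplicialComplex V) : Prop :=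
  ∃ F : Set (Finset V), (∀ A ∈ F, A.card = d + 2) ∧
    (∀ A ∈ F, ∀ B ∈ F, A ≠ B → Disjoint A B) ∧
    dFaces d Y = {σ | σ.card = d + 1 ∧ ∃ A ∈ F, σ ⊆ A}

/-- The complex on the vertex set `V` with full `(d-1)`-skeleton whose `d`-faces are
the members of `S` with `d + 1` vertices. -/
def complexOf (d : ℕ) (S : Set (Finset V)) : PreAbstractSimplicialComplex V where
  faces := {s | s.Nonempty ∧ (s.card ≤ d ∨ s.card = d + 1 ∧ s ∈ S)}
  isRelLowerSet_faces := by
    rintro s ⟨hs, h⟩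
    refine ⟨hs, fun t hts ht => ⟨ht, ?_⟩⟩
    have hle : t.card ≤ s.card := Finset.card_le_card hts
    rcases h with h | ⟨h, hS⟩
    · exact Or.inl (hle.trans h)
    · rcases Nat.lt_or_ge d t.card with h' | h'
      · have : t = s := Finset.eq_of_subset_of_card_le hts (by omega)
        subst this
        exact Or.inr ⟨h, hS⟩
      · exact Or.inl h'

/-- The probability that `Y_d(n, p)` has property `P`: on the vertex set `Fin n`, each set of
`d + 1` vertices is a `d`-face independently with probability `p`. -/
noncomputable def prob (d n : ℕ) (p : unitInterval)
    (P : PreAbstractSimplicialComplex (Fin n) → Prop) : ENNReal :=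
  setBernoulli {σ : Finset (Fin n) | σ.card = d + 1} p {S | P (complexOf d S)}

/-- The number `c / n` as a probability; it is truncated to `[0, 1]`, which for `c > 0` has an
effect only for the finitely many `n < c`. -/
noncomputable def edgeProb (c : ℝ) (n : ℕ) : unitInterval :=
  Set.projIcc 0 1 zero_le_one (c / n)

/-- On a finite vertex set, every complex of dimension at most `d` has a full `d`-collapse. -/
theorem exists_isFullCollapse [Finite V] (d : ℕ) (Y : PreAbstractSimplicialComplex V)
    (hY : ∀ s ∈ Y.faces, s.card ≤ d + 1) : ∃ R, IsFullCollapse d Y R := by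
  induction h : Y.faces.ncard using Nat.strong_induction_on generalizing Y with
  | _ m ih =>
    by_cases hfree : ∀ τ σ, ¬ IsFreePair d Y τ σ
    · exact ⟨Y, Relation.ReflTransGen.refl, hfree⟩
    · push Not at hfree
      obtain ⟨τ, σ, hp⟩ := hfree
      obtain ⟨⟨hτ, hτc⟩, ⟨⟨hσ, hσc⟩, hτσ⟩, huniq⟩ := id hp
      let Y' : PreAbstractSimplicialComplex V :=
        { faces := Y.faces \ {τ, σ}
          isRelLowerSet_faces := by
            rintro s ⟨hs, hne⟩
            simp only [Set.mem_insert_iff, Set.mem_singleton_iff, not_or] at hne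
            refine ⟨(Y.isRelLowerSet_faces hs).1, fun t hts ht =>
              ⟨(Y.isRelLowerSet_faces hs).2 hts ht, ?_⟩⟩
            have hsc := hY s hs
            simp only [Set.mem_insert_iff, Set.mem_singleton_iff, not_or]
            refine ⟨?_, ?_⟩
            · rintro rfl
              rcases Nat.lt_or_ge d s.card with h' | h'
              · exact hne.2 (huniq s ⟨hs, by omega⟩ hts)
              · exact hne.1 (Finset.eq_of_subset_of_card_le hts (by omega)).symm
            · rintro rfl
              exact hne.2 (Finset.eq_of_subset_of_card_le hts (by omega)).symm }
      have hlt : Y'.faces.ncard < m := by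
        rw [← h]
        refine Set.ncard_lt_ncard ⟨Set.sdiff_subset, fun hsub => ?_⟩ (Set.toFinite _)
        exact (hsub hτ).2 (by simp)
      obtain ⟨R, hR, hR'⟩ := ih _ hlt Y' (fun s hs => hY s hs.1) rfl
      exact ⟨R, Relation.ReflTransGen.head ⟨τ, σ, hp, rfl⟩ hR, hR'⟩

end RandomComplex

/-!
The `d`-faces of a full collapse form a *core*: every `d`-set in a face lies in a second face. If a
core is not gravel, it contains a minimal core that is not gravel, a *minimal bad core*. The proof
is a first moment computation: the expected number of minimal bad cores `T` with `m ≤ α n ^ d`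
members among the random faces, which is the number of such `T` times `(c / n) ^ m`, tends to zero
when summed over `m`.

For `m` at most a multiple of `log n` it is enough that `T` has at most `(1 - γ) m` vertices for
some `γ > 0` that depends only on `d` (`IsMinimalBadCore.card_vertices_le`), so that there are at
most `n ^ ((1 - γ) m) * (log n) ^ O(m)` cores. Indeed every vertex of a core has degree at least
`d + 1`, equality forces the star of the vertex to be that of a vertex of a simplex boundary, and
`T` contains no simplex boundary that is isolated from its other members
(`IsMinimalBadCore.exists_inter_nonempty`).

For larger `m`, the core is rebuilt from a seed of at most `d + 3` members
(`IsMinimalBadCore.exists_seed`). A subfamily of `T` that contains the seed and is not all of `T`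
is not a core, hence has a `d`-set `τ` that lies in only one of its members, and is extended by
another member `insert u τ` of `T`. There are `n` choices for `u`, which just balances the
probability `c / n`. The point is that in a positive fraction of the steps there are only `δ n`
choices, where `δ` is as small as needed (`mem_explore`).

To see this, call a `(d-1)`-set heavy if it lies in at least `ε n` members of the shadow of `T`,
and, recursively, a smaller set heavy if it lies in at least `ε_k n` heavy sets with one more
element. The heavy `(d-1)`-sets are so few that they can be listed in advance at a cost of only
`2 ^ m`. A vertex `u` is *saving* for `τ` if adding it turns a non-heavy subset of `τ` into a heavy
set or a member of the shadow of the present family; there are at most `2 ^ d ε n` such vertices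
(`card_savingVertices_le`). If `u` is not saving, then, unless `τ` is one of few exceptional sets
(`card_isTangled_le`), more than half of the `d`-subsets of `insert u τ` without heavy subsets are
new (`card_lightFacets_lt`). As each of these `d`-sets lies in at least two members of the core `T`
in the end, this cannot happen in too many steps. Here `d ≥ 2` enters.
-/

namespace RandomComplex

/-! ### Cores and gravel as families of sets -/

section Core

variable {V : Type*} {d : ℕ}

/-- A family of `(d+1)`-sets is a core if no `d`-set is contained in exactly one of its members. -/
def IsCore (d : ℕ) (T : Finset (Finset V)) : Prop :=
  ∀ σ ∈ T, σ.card = d + 1 ∧ ∀ τ ⊆ σ, τ.card = d → ∃ σ' ∈ T, σ' ≠ σ ∧ τ ⊆ σ'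

/-- A family of `(d+1)`-sets is gravel if it is the family of facets of pairwise disjoint
`(d+1)`-simplices. -/
def IsGravelFamily (d : ℕ) (T : Finset (Finset V)) : Prop :=
  ∃ F : Set (Finset V), (∀ A ∈ F, A.card = d + 2) ∧
    (∀ A ∈ F, ∀ B ∈ F, A ≠ B → Disjoint A B) ∧
    (T : Set (Finset V)) = {σ | σ.card = d + 1 ∧ ∃ A ∈ F, σ ⊆ A}

/-- A core that is not gravel and has no proper subfamily with these two properties. -/
structure IsMinimalBadCore (d : ℕ) (T : Finset (Finset V)) : Prop where
  isCore : IsCore d T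
  not_gravel : ¬ IsGravelFamily d T
  gravel_of_ssubset : ∀ P ⊂ T, IsCore d P → IsGravelFamily d P

theorem IsCore.exists_isMinimalBadCore {T : Finset (Finset V)} (hT : IsCore d T)
    (hg : ¬ IsGravelFamily d T) : ∃ T₁ ⊆ T, IsMinimalBadCore d T₁ := by
  induction T using Finset.strongInduction with
  | H T ih =>
    by_cases h : ∀ P ⊂ T, IsCore d P → IsGravelFamily d P
    · exact ⟨T, subset_rfl, hT, hg, h⟩
    · push Not at h
      obtain ⟨P, hPT, hP, hPg⟩ := h
      obtain ⟨T₁, h₁, h₂⟩ := ih P hPT hP hPg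
      exact ⟨T₁, h₁.trans hPT.subset, h₂⟩

theorem IsMinimalBadCore.eq_of_isCore {T P : Finset (Finset V)} (hT : IsMinimalBadCore d T)
    (hPT : P ⊆ T) (hP : IsCore d P) (hg : ¬ IsGravelFamily d P) : P = T := by
  by_contra hne
  exact hg (hT.gravel_of_ssubset P (hPT.ssubset_of_ne hne) hP)

theorem isGravelFamily_empty : IsGravelFamily d (∅ : Finset (Finset V)) :=
  ⟨∅, by simp, by simp, by simp⟩

theorem IsMinimalBadCore.nonempty {T : Finset (Finset V)} (hT : IsMinimalBadCore d T) :
    T.Nonempty := by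
  rw [Finset.nonempty_iff_ne_empty]
  rintro rfl
  exact hT.not_gravel isGravelFamily_empty

theorem IsGravelFamily.isGravel {T : Finset (Finset V)} {R : PreAbstractSimplicialComplex V}
    (hT : IsGravelFamily d T) (h : (T : Set (Finset V)) = dFaces d R) : IsGravel d R := by
  obtain ⟨F, h₁, h₂, h₃⟩ := hT
  exact ⟨F, h₁, h₂, h ▸ h₃⟩

/-- The `d`-faces of a complex without free `(d-1)`-faces form a core. -/
theorem isCore_of_forall_not_isFreePair {T : Finset (Finset V)}
    {R : PreAbstractSimplicialComplex V} (hd : 1 ≤ d) (hR : ∀ τ σ, ¬ IsFreePair d R τ σ)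
    (h : (T : Set (Finset V)) = dFaces d R) : IsCore d T := by
  intro σ hσ
  have hσ' : σ ∈ dFaces d R := h ▸ hσ
  refine ⟨hσ'.2, fun τ hτ hτc => ?_⟩
  by_contra! hcon
  refine hR τ σ ⟨⟨(R.isRelLowerSet_faces hσ'.1).2 hτ (Finset.card_pos.1 (by omega)), hτc⟩,
    ⟨hσ', hτ⟩, fun σ' hσ'' hτ' => ?_⟩
  by_contra hne
  exact hcon σ' (by rw [← Finset.mem_coe, h]; exact hσ'') hne hτ'

theorem faces_subset_of_collapse {Y R : PreAbstractSimplicialComplex V}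
    (h : Relation.ReflTransGen (ElementaryCollapse d) Y R) : R.faces ⊆ Y.faces := by
  induction h with
  | refl => exact subset_rfl
  | tail _ h ih =>
    obtain ⟨τ, σ, -, h⟩ := h
    rw [h]
    exact Set.sdiff_subset.trans ih

theorem mem_of_mem_dFaces_complexOf {S : Set (Finset V)} {σ : Finset V}
    (h : σ ∈ dFaces d (complexOf d S)) : σ ∈ S := by
  obtain ⟨⟨-, h | h⟩, hc⟩ := h
  · omega
  · exact h.2

/-- A full collapse that is neither gravel nor large leaves a small minimal bad core among the
`d`-faces of the original complex. -/
theorem exists_isMinimalBadCore_of_isFullCollapse [Finite V] (hd : 1 ≤ d) {S : Set (Finset V)}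
    {R : PreAbstractSimplicialComplex V} (hR : IsFullCollapse d (complexOf d S) R)
    (hg : ¬ IsGravel d R) :
    ∃ T : Finset (Finset V), IsMinimalBadCore d T ∧ T.card ≤ faceNumber d R ∧
      (T : Set (Finset V)) ⊆ S := by
  have hfin : (dFaces d R).Finite := Set.toFinite _
  have hcoe : (hfin.toFinset : Set (Finset V)) = dFaces d R := hfin.coe_toFinset
  obtain ⟨T, hT, hTmin⟩ := (isCore_of_forall_not_isFreePair hd hR.2 hcoe).exists_isMinimalBadCore
    (fun h => hg (h.isGravel hcoe))
  refine ⟨T, hTmin, ?_, fun σ hσ => ?_⟩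
  · rw [faceNumber, ← hcoe, Set.ncard_coe_finset]
    exact Finset.card_le_card hT
  · have : σ ∈ dFaces d R := hcoe ▸ hT hσ
    exact mem_of_mem_dFaces_complexOf ⟨faces_subset_of_collapse hR.1 this.1, this.2⟩

variable [DecidableEq V]

/-- A simplex boundary none of whose vertices lies in another member of `T` can be removed from
`T`; hence a minimal bad core has none. -/
theorem IsMinimalBadCore.exists_inter_nonempty {T : Finset (Finset V)}
    (hT : IsMinimalBadCore d T) (hd : 1 ≤ d) {A : Finset V} (hA : A.card = d + 2)
    (hAT : A.powersetCard (d + 1) ⊆ T) : ∃ σ ∈ T, ¬ σ ⊆ A ∧ (σ ∩ A).Nonempty := by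
  classical
  by_contra! hiso
  have hdisj : ∀ σ ∈ T, ¬ σ ⊆ A → Disjoint σ A := fun σ hσ hσA =>
    Finset.disjoint_iff_inter_eq_empty.2 (hiso σ hσ hσA)
  have hmem : ∀ σ, σ ∈ T \ A.powersetCard (d + 1) ↔ σ ∈ T ∧ ¬ σ ⊆ A := by
    intro σ
    rw [Finset.mem_sdiff, Finset.mem_powersetCard]
    constructor
    · rintro ⟨h, h'⟩
      exact ⟨h, fun h'' => h' ⟨h'', (hT.isCore σ h).1⟩⟩
    · rintro ⟨h, h'⟩
      exact ⟨h, fun h'' => h' h''.1⟩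
  obtain ⟨σ₀, hσ₀A, hσ₀⟩ : ∃ σ₀ ⊆ A, σ₀.card = d + 1 :=
    Finset.exists_subset_card_eq (by omega)
  have hσ₀T : σ₀ ∈ T := hAT (Finset.mem_powersetCard.2 ⟨hσ₀A, hσ₀⟩)
  have hcore : IsCore d (T \ A.powersetCard (d + 1)) := by
    intro σ hσ
    rw [hmem] at hσ
    refine ⟨(hT.isCore σ hσ.1).1, fun τ hτ hτc => ?_⟩
    obtain ⟨σ', hσ', hne, hτ'⟩ := (hT.isCore σ hσ.1).2 τ hτ hτc
    refine ⟨σ', (hmem σ').2 ⟨hσ', fun hσ'A => ?_⟩, hne, hτ'⟩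
    obtain ⟨x, hx⟩ : τ.Nonempty := Finset.card_pos.1 (by omega)
    exact Finset.disjoint_left.1 (hdisj σ hσ.1 hσ.2) (hτ hx) (hσ'A (hτ' hx))
  have hss : T \ A.powersetCard (d + 1) ⊂ T := by
    refine Finset.ssubset_iff_subset_ne.2 ⟨Finset.sdiff_subset, fun h => ?_⟩
    have : σ₀ ∈ T \ A.powersetCard (d + 1) := by rw [h]; exact hσ₀T
    exact ((hmem σ₀).1 this).2 hσ₀A
  obtain ⟨F, hF₁, hF₂, hF₃⟩ := hT.gravel_of_ssubset _ hss hcore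
  have hFT : ∀ B ∈ F, ∀ σ ⊆ B, σ.card = d + 1 → σ ∈ T ∧ ¬ σ ⊆ A := by
    intro B hB σ hσB hσ
    rw [← hmem, ← Finset.mem_coe, hF₃]
    exact ⟨hσ, B, hB, hσB⟩
  have hFA : ∀ B ∈ F, Disjoint B A := by
    intro B hB
    rw [Finset.disjoint_left]
    intro x hxB
    obtain ⟨σ, hσ₁, hσ₂, hσ⟩ := Finset.exists_subsuperset_card_eq
      (Finset.singleton_subset_iff.2 hxB) (n := d + 1) (by simp) (by rw [hF₁ B hB]; omega)
    have := hFT B hB σ hσ₂ hσ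
    exact Finset.disjoint_left.1 (hdisj σ this.1 this.2) (hσ₁ (by simp))
  refine hT.not_gravel ⟨insert A F, ?_, ?_, ?_⟩
  · rintro B (rfl | hB)
    exacts [hA, hF₁ B hB]
  · rintro B (rfl | hB) C (rfl | hC) hne
    exacts [absurd rfl hne, (hFA C hC).symm, hFA B hB, hF₂ B hB C hC hne]
  · ext σ
    simp only [Finset.mem_coe, Set.mem_ofPred_eq, Set.mem_insert_iff, exists_eq_or_imp]
    constructor
    · intro hσ
      refine ⟨(hT.isCore σ hσ).1, ?_⟩
      by_cases hσA : σ ⊆ A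
      · exact Or.inl hσA
      · have : σ ∈ ((T \ A.powersetCard (d + 1) : Finset _) : Set (Finset V)) :=
          Finset.mem_coe.2 ((hmem σ).2 ⟨hσ, hσA⟩)
        rw [hF₃] at this
        exact Or.inr this.2
    · rintro ⟨hσ, h | ⟨B, hB, hσB⟩⟩
      · exact hAT (Finset.mem_powersetCard.2 ⟨h, hσ⟩)
      · exact (hFT B hB σ hσB hσ).1

/-- A minimal bad core is the only core between itself and a suitable subfamily of bounded size.
This allows to rebuild it by adding one member at a time, always at a `d`-set contained in exactly
one member of the part that is already there. -/
theorem IsMinimalBadCore.exists_seed {T : Finset (Finset V)}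
    (hT : IsMinimalBadCore d T) (hd : 1 ≤ d) :
    ∃ I ⊆ T, I.card ≤ d + 3 ∧ ∀ P ⊆ T, I ⊆ P → IsCore d P → P = T := by
  classical
  by_cases h : ∃ A : Finset V, A.card = d + 2 ∧ A.powersetCard (d + 1) ⊆ T
  · obtain ⟨A, hA, hAT⟩ := h
    obtain ⟨σ, hσ, hσA, x, hx⟩ := hT.exists_inter_nonempty hd hA hAT
    rw [Finset.mem_inter] at hx
    refine ⟨insert σ (A.powersetCard (d + 1)), Finset.insert_subset hσ hAT, ?_, ?_⟩
    · refine (Finset.card_insert_le _ _).trans ?_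
      rw [Finset.card_powersetCard, hA, Nat.choose_succ_self_right]
    · intro P hPT hIP hP
      refine hT.eq_of_isCore hPT hP ?_
      rintro ⟨F, hF₁, hF₂, hF₃⟩
      have hPF : ∀ ρ ∈ P, ∃ B ∈ F, ρ ⊆ B := by
        intro ρ hρ
        rw [← Finset.mem_coe, hF₃] at hρ
        exact hρ.2
      have hAP : ∀ ρ ⊆ A, ρ.card = d + 1 → ∃ B ∈ F, ρ ⊆ B := fun ρ hρ hρc =>
        hPF ρ (hIP (Finset.mem_insert_of_mem (Finset.mem_powersetCard.2 ⟨hρ, hρc⟩)))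
      have huniq : ∀ B ∈ F, ∀ C ∈ F, ∀ y ∈ B, y ∈ C → B = C := by
        intro B hB C hC y hyB hyC
        by_contra hne
        exact Finset.disjoint_left.1 (hF₂ B hB C hC hne) hyB hyC
      -- All facets of `A` through `x` lie in the member of the gravel that contains `x`.
      obtain ⟨B, hB, hσB⟩ := hPF σ (hIP (Finset.mem_insert_self _ _))
      have hAB : A ⊆ B := by
        intro y hy
        obtain ⟨ρ, hρ₁, hρ₂, hρ⟩ := Finset.exists_subsuperset_card_eq (s := {x, y}) (t := A)
          (n := d + 1) (by simp [Finset.insert_subset_iff, hx.2, hy])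
          (Finset.card_le_two.trans (by omega)) (by omega)
        obtain ⟨C, hC, hρC⟩ := hAP ρ hρ₂ hρ
        rw [huniq B hB C hC x (hσB hx.1) (hρC (hρ₁ (by simp)))]
        exact hρC (hρ₁ (by simp))
      have : A = B := Finset.eq_of_subset_of_card_le hAB (by rw [hA, hF₁ B hB])
      exact hσA (this ▸ hσB)
  · obtain ⟨σ, hσ⟩ := hT.nonempty
    refine ⟨{σ}, by simpa using hσ, by simp, fun P hPT hIP hP => hT.eq_of_isCore hPT hP ?_⟩
    rintro ⟨F, hF₁, -, hF₃⟩
    have hσP : σ ∈ (P : Set (Finset V)) := hIP (by simp)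
    rw [hF₃] at hσP
    obtain ⟨-, A, hA, -⟩ := hσP
    refine h ⟨A, hF₁ A hA, fun ρ hρ => hPT ?_⟩
    rw [Finset.mem_powersetCard] at hρ
    rw [← Finset.mem_coe, hF₃]
    exact ⟨hρ.2, A, hA, hρ.1⟩

end Core

/-! ### The number of vertices of a bad core -/

section Degree

variable {V : Type*} [DecidableEq V] {d : ℕ} {T : Finset (Finset V)}

/-- The number of members of `T` that contain `x`. -/
def vertexDegree (T : Finset (Finset V)) (x : V) : ℕ := (T.filter (x ∈ ·)).card

/-- In a core, the members that contain the vertex `x` are at least `d + 1` in number. If there are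
exactly `d + 1`, they are the facets through `x` of a `(d+1)`-simplex. -/
theorem IsCore.le_vertexDegree (hT : IsCore d T) (hd : 2 ≤ d) {x : V} {σ : Finset V} (hσ : σ ∈ T)
    (hx : x ∈ σ) : d + 1 ≤ vertexDegree T x ∧ (vertexDegree T x = d + 1 →
      ∃ A : Finset V, A.card = d + 2 ∧
        ∀ ρ, ρ ∈ T ∧ x ∈ ρ ↔ ρ ⊆ A ∧ ρ.card = d + 1 ∧ x ∈ ρ) := by
  classical
  have hσc : σ.card = d + 1 := (hT σ hσ).1
  -- `f w` is a second member that contains `σ.erase w`; these members are distinct and, for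
  -- `w ≠ x`, contain `x`.
  have hex : ∀ w ∈ σ, ∃ σ' ∈ T, σ' ≠ σ ∧ σ.erase w ⊆ σ' := fun w hw =>
    (hT σ hσ).2 _ (Finset.erase_subset _ _) (by rw [Finset.card_erase_of_mem hw]; omega)
  choose! f hfT hfne hf using hex
  have hfc : ∀ w ∈ σ, (f w).card = d + 1 := fun w hw => (hT _ (hfT w hw)).1
  have hwf : ∀ w ∈ σ, w ∉ f w := by
    intro w hw hwf
    refine hfne w hw (Finset.eq_of_subset_of_card_le (fun z hz => ?_) (by
      rw [hσc, hfc w hw])).symm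
    by_cases h : z = w
    · rwa [h]
    · exact hf w hw (Finset.mem_erase.2 ⟨h, hz⟩)
  have hsub : insert σ ((σ.erase x).image f) ⊆ T.filter (x ∈ ·) := by
    intro ρ hρ
    rw [Finset.mem_insert, Finset.mem_image] at hρ
    rw [Finset.mem_filter]
    rcases hρ with rfl | ⟨w, hw, rfl⟩
    · exact ⟨hσ, hx⟩
    · rw [Finset.mem_erase] at hw
      exact ⟨hfT w hw.2, hf w hw.2 (Finset.mem_erase.2 ⟨hw.1.symm, hx⟩)⟩
  have hcard : (insert σ ((σ.erase x).image f)).card = d + 1 := by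
    rw [Finset.card_insert_of_notMem, Finset.card_image_of_injOn, Finset.card_erase_of_mem hx]
    · omega
    · intro w hw w' hw' heq
      rw [Finset.mem_coe, Finset.mem_erase] at hw hw'
      by_contra hne
      refine hwf w' hw'.2 ?_
      rw [← heq]
      exact hf w hw.2 (Finset.mem_erase.2 ⟨fun h => hne h.symm, hw'.2⟩)
    · intro h
      obtain ⟨w, hw, h⟩ := Finset.mem_image.1 h
      exact hfne w (Finset.mem_of_mem_erase hw) h
  refine ⟨hcard ▸ Finset.card_le_card hsub, fun hdeg => ?_⟩
  have hstar : insert σ ((σ.erase x).image f) = T.filter (x ∈ ·) :=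
    Finset.eq_of_subset_of_card_le hsub (by rw [hcard]; exact hdeg.le)
  have hstar' : ∀ ρ ∈ T, x ∈ ρ → ρ = σ ∨ ∃ w ∈ σ, w ≠ x ∧ f w = ρ := by
    intro ρ hρ hxρ
    have : ρ ∈ insert σ ((σ.erase x).image f) := by
      rw [hstar]; exact Finset.mem_filter.2 ⟨hρ, hxρ⟩
    rw [Finset.mem_insert, Finset.mem_image] at this
    rcases this with h | ⟨w, hw, h⟩
    · exact Or.inl h
    · exact Or.inr ⟨w, Finset.mem_of_mem_erase hw, Finset.ne_of_mem_erase hw, h⟩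
  obtain ⟨w₀, hw₀⟩ : (σ.erase x).Nonempty := by
    rw [← Finset.card_pos, Finset.card_erase_of_mem hx]; omega
  rw [Finset.mem_erase] at hw₀
  obtain ⟨y, hyf, hyσ⟩ : ∃ y ∈ f w₀, y ∉ σ := by
    by_contra! hcon
    exact hfne w₀ hw₀.2 (Finset.eq_of_subset_of_card_le hcon (by rw [hσc, hfc w₀ hw₀.2]))
  -- The `d`-set `(f w₀).erase w` lies in a second member, and this can only be `f w`.
  have hyf' : ∀ w ∈ σ, w ≠ x → y ∈ f w := by
    intro w hw hwx
    by_cases hww : w = w₀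
    · rwa [hww]
    have hwf₀ : w ∈ f w₀ := hf w₀ hw₀.2 (Finset.mem_erase.2 ⟨hww, hw⟩)
    have hxf₀ : x ∈ f w₀ := hf w₀ hw₀.2 (Finset.mem_erase.2 ⟨hw₀.1.symm, hx⟩)
    obtain ⟨ρ, hρT, hρne, hρ⟩ := (hT _ (hfT w₀ hw₀.2)).2 ((f w₀).erase w)
      (Finset.erase_subset _ _) (by rw [Finset.card_erase_of_mem hwf₀, hfc w₀ hw₀.2]; omega)
    have hyρ : y ∈ ρ := hρ (Finset.mem_erase.2 ⟨fun h => hyσ (h ▸ hw), hyf⟩)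
    rcases hstar' ρ hρT (hρ (Finset.mem_erase.2 ⟨hwx.symm, hxf₀⟩)) with rfl | ⟨v, hv, hvx, rfl⟩
    · exact absurd hyρ hyσ
    · have hvw₀ : v ≠ w₀ := fun h => hρne (by rw [h])
      have : v = w := by
        by_contra hvw
        exact hwf v hv (hρ (Finset.mem_erase.2 ⟨hvw,
          hf w₀ hw₀.2 (Finset.mem_erase.2 ⟨hvw₀, hv⟩)⟩))
      rwa [← this]
  have hA : (insert y σ).card = d + 2 := by rw [Finset.card_insert_of_notMem hyσ, hσc]
  have hsubA : ∀ ρ ∈ T, x ∈ ρ → ρ ⊆ insert y σ := by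
    intro ρ hρ hxρ
    rcases hstar' ρ hρ hxρ with rfl | ⟨w, hw, hwx, rfl⟩
    · exact Finset.subset_insert _ _
    · have : insert y (σ.erase w) = f w := by
        refine Finset.eq_of_subset_of_card_le
          (Finset.insert_subset (hyf' w hw hwx) (hf w hw)) ?_
        rw [Finset.card_insert_of_notMem (fun h => hyσ (Finset.mem_of_mem_erase h)),
          Finset.card_erase_of_mem hw, hfc w hw]
        omega
      rw [← this]
      exact Finset.insert_subset_insert _ (Finset.erase_subset _ _)
  refine ⟨insert y σ, hA, ?_⟩
  have hsub₂ : T.filter (x ∈ ·) ⊆ ((insert y σ).powersetCard (d + 1)).filter (x ∈ ·) := by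
    intro ρ hρ
    rw [Finset.mem_filter] at hρ
    rw [Finset.mem_filter, Finset.mem_powersetCard]
    exact ⟨⟨hsubA ρ hρ.1 hρ.2, (hT ρ hρ.1).1⟩, hρ.2⟩
  have hcard₂ : (((insert y σ).powersetCard (d + 1)).filter (x ∈ ·)).card ≤ d + 1 := by
    have : ((insert y σ).powersetCard (d + 1)).filter (x ∈ ·) ⊆
        ((insert y σ).erase x).image (fun w => (insert y σ).erase w) := by
      intro ρ hρ
      rw [Finset.mem_filter, Finset.mem_powersetCard] at hρ
      obtain ⟨w, hw, hwρ⟩ : ∃ w ∈ insert y σ, w ∉ ρ := by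
        by_contra! hcon
        have := Finset.card_le_card (show insert y σ ⊆ ρ from hcon)
        omega
      refine Finset.mem_image.2 ⟨w, Finset.mem_erase.2 ⟨fun h => hwρ (h ▸ hρ.2), hw⟩, ?_⟩
      refine (Finset.eq_of_subset_of_card_le (fun z hz => ?_) ?_).symm
      · exact Finset.mem_erase.2 ⟨fun h => hwρ (h ▸ hz), hρ.1.1 hz⟩
      · rw [Finset.card_erase_of_mem hw, hρ.1.2]; omega
    refine (Finset.card_le_card this).trans (Finset.card_image_le.trans ?_)
    rw [Finset.card_erase_of_mem (Finset.mem_insert_of_mem hx)]; omega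
  have heq := Finset.eq_of_subset_of_card_le hsub₂ (hcard₂.trans hdeg.ge)
  intro ρ
  have := congrArg (ρ ∈ ·) heq
  simpa only [Finset.mem_filter, Finset.mem_powersetCard, eq_iff_iff, and_assoc] using this

/-- `A` carries the star of `x` in `T`: the members of `T` through `x` are the facets through `x` of
the simplex `A`. -/
def IsSimplexStar (d : ℕ) (T : Finset (Finset V)) (x : V) (A : Finset V) : Prop :=
  A.card = d + 2 ∧ ∀ ρ, ρ ∈ T ∧ x ∈ ρ ↔ ρ ⊆ A ∧ ρ.card = d + 1 ∧ x ∈ ρ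

theorem IsSimplexStar.eq {x y : V} {A B : Finset V} (hd : 2 ≤ d) (hA : IsSimplexStar d T x A)
    (hB : IsSimplexStar d T y B) (hx : x ∈ A) (hy : y ∈ A) : A = B := by
  refine Finset.eq_of_subset_of_card_le (fun z hz => ?_) (by rw [hA.1, hB.1])
  obtain ⟨ρ, hρ₁, hρ₂, hρ⟩ := Finset.exists_subsuperset_card_eq (s := {x, y, z}) (t := A)
    (n := d + 1) (by simp [Finset.insert_subset_iff, hx, hy, hz])
    (Finset.card_le_three.trans (by omega)) (by rw [hA.1]; omega)
  have h₁ := (hA.2 ρ).2 ⟨hρ₂, hρ, hρ₁ (by simp)⟩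
  exact ((hB.2 ρ).1 ⟨h₁.1, hρ₁ (by simp)⟩).1 (hρ₁ (by simp))

/-- A member of a minimal bad core all of whose vertices have degree `d + 1` is a facet of
a simplex with all facets in the core, and the remaining vertex of this simplex has larger
degree. -/
theorem IsMinimalBadCore.exists_apex (hT : IsMinimalBadCore d T) (hd : 2 ≤ d) {σ : Finset V}
    (hσ : σ ∈ T) (hlight : ∀ x ∈ σ, vertexDegree T x = d + 1) :
    ∃ y ∉ σ, d + 2 ≤ vertexDegree T y ∧ (∀ x ∈ σ, IsSimplexStar d T x (insert y σ)) ∧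
      (insert y σ).powersetCard (d + 1) ⊆ T := by
  have hσc : σ.card = d + 1 := (hT.isCore σ hσ).1
  obtain ⟨b, hb⟩ : σ.Nonempty := Finset.card_pos.1 (by omega)
  obtain ⟨A, hA⟩ : ∃ A, IsSimplexStar d T b A :=
    (hT.isCore.le_vertexDegree hd hσ hb).2 (hlight b hb)
  have hσA : σ ⊆ A := ((hA.2 σ).1 ⟨hσ, hb⟩).1
  have hstar : ∀ x ∈ σ, IsSimplexStar d T x A := by
    intro x hx
    obtain ⟨B, hB⟩ : ∃ B, IsSimplexStar d T x B :=
      (hT.isCore.le_vertexDegree hd hσ hx).2 (hlight x hx)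
    rwa [hA.eq hd hB (hσA hb) (hσA hx)]
  have hAT : A.powersetCard (d + 1) ⊆ T := by
    intro ρ hρ
    rw [Finset.mem_powersetCard] at hρ
    have hne : (ρ ∩ σ).Nonempty := by
      rw [← Finset.card_pos]
      have h₁ := Finset.card_union_add_card_inter ρ σ
      have h₂ := Finset.card_le_card (Finset.union_subset hρ.1 hσA)
      have h₃ := hA.1
      omega
    obtain ⟨x, hx⟩ := hne
    rw [Finset.mem_inter] at hx
    exact (((hstar x hx.2).2 ρ).2 ⟨hρ.1, hρ.2, hx.1⟩).1
  obtain ⟨ρ, hρT, hρA, y, hy⟩ := hT.exists_inter_nonempty (by omega) hA.1 hAT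
  rw [Finset.mem_inter] at hy
  have hyσ : y ∉ σ := fun h => hρA (((hstar y h).2 ρ).1 ⟨hρT, hy.1⟩).1
  have hAeq : insert y σ = A := Finset.eq_of_subset_of_card_le (Finset.insert_subset hy.2 hσA)
    (by rw [Finset.card_insert_of_notMem hyσ, hA.1, hσc])
  refine ⟨y, hyσ, ?_, hAeq.symm ▸ hstar, hAeq.symm ▸ hAT⟩
  have hle := hT.isCore.le_vertexDegree hd hρT hy.1
  rcases hle.1.lt_or_eq with h | h
  · exact h
  · obtain ⟨B, hB⟩ : ∃ B, IsSimplexStar d T y B := hle.2 h.symm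
    rw [← hA.eq hd hB (hσA hb) hy.2] at hB
    exact absurd ((hB.2 ρ).1 ⟨hρT, hy.1⟩).1 hρA

/-- At least half of the members of a minimal bad core have a vertex of degree at least `d + 2`. -/
theorem IsMinimalBadCore.card_le_two_mul (hT : IsMinimalBadCore d T) (hd : 2 ≤ d) :
    T.card ≤ 2 * (T.filter fun σ => ∃ x ∈ σ, d + 2 ≤ vertexDegree T x).card := by
  classical
  have hsplit := Finset.card_filter_add_card_filter_not (s := T)
    (fun σ => ∃ x ∈ σ, d + 2 ≤ vertexDegree T x)
  suffices h : (T.filter fun σ => ¬ ∃ x ∈ σ, d + 2 ≤ vertexDegree T x).card ≤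
      (T.filter fun σ => ∃ x ∈ σ, d + 2 ≤ vertexDegree T x).card by omega
  have hmem : ∀ σ ∈ T.filter fun σ => ¬ ∃ x ∈ σ, d + 2 ≤ vertexDegree T x,
      σ ∈ T ∧ ∀ x ∈ σ, vertexDegree T x = d + 1 := by
    intro σ hσ
    rw [Finset.mem_filter] at hσ
    refine ⟨hσ.1, fun x hx => le_antisymm ?_ (hT.isCore.le_vertexDegree hd hσ.1 hx).1⟩
    by_contra! hlt
    exact hσ.2 ⟨x, hx, hlt⟩
  have hex : ∀ σ ∈ T.filter fun σ => ¬ ∃ x ∈ σ, d + 2 ≤ vertexDegree T x,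
      ∃ y b, b ∈ σ ∧ y ∉ σ ∧ d + 2 ≤ vertexDegree T y ∧
        (∀ x ∈ σ, IsSimplexStar d T x (insert y σ)) ∧ (insert y σ).powersetCard (d + 1) ⊆ T := by
    intro σ hσ
    obtain ⟨hσT, hl⟩ := hmem σ hσ
    obtain ⟨b, hb⟩ : σ.Nonempty := Finset.card_pos.1 (by rw [(hT.isCore σ hσT).1]; omega)
    obtain ⟨y, h⟩ := hT.exists_apex hd hσT hl
    exact ⟨y, b, hb, h⟩
  have : Nonempty V := by
    obtain ⟨σ, hσ⟩ := hT.nonempty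
    obtain ⟨x, -⟩ : σ.Nonempty := Finset.card_pos.1 (by rw [(hT.isCore σ hσ).1]; omega)
    exact ⟨x⟩
  choose! y b hb hy hydeg hstar hyT using hex
  -- A member without vertices of large degree is sent to another facet of the same simplex.
  refine Finset.card_le_card_of_injOn (fun σ => (insert (y σ) σ).erase (b σ)) ?_ ?_
  · intro σ hσ
    have hσ' := Finset.mem_coe.1 hσ
    rw [Finset.mem_coe, Finset.mem_filter]
    refine ⟨hyT σ hσ' (Finset.mem_powersetCard.2 ⟨Finset.erase_subset _ _, ?_⟩), y σ, ?_,
      hydeg σ hσ'⟩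
    · rw [Finset.card_erase_of_mem (Finset.mem_insert_of_mem (hb σ hσ')),
        Finset.card_insert_of_notMem (hy σ hσ'), (hT.isCore σ (hmem σ hσ').1).1]
      omega
    · exact Finset.mem_erase.2 ⟨fun h => hy σ hσ' (h ▸ hb σ hσ'), Finset.mem_insert_self _ _⟩
  · intro σ hσ σ' hσ' heq
    rw [Finset.mem_coe] at hσ hσ'
    simp only at heq
    have hσc : σ.card = d + 1 := (hT.isCore σ (hmem σ hσ).1).1
    obtain ⟨x, hx⟩ : (σ.erase (b σ)).Nonempty := by
      rw [← Finset.card_pos, Finset.card_erase_of_mem (hb σ hσ)]; omega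
    rw [Finset.mem_erase] at hx
    have hdx : vertexDegree T x = d + 1 := (hmem σ hσ).2 x hx.2
    have hx' : x ∈ insert (y σ') σ' := by
      have : x ∈ (insert (y σ) σ).erase (b σ) :=
        Finset.mem_erase.2 ⟨hx.1, Finset.mem_insert_of_mem hx.2⟩
      rw [heq] at this
      exact Finset.mem_of_mem_erase this
    have hxσ' : x ∈ σ' := by
      rcases Finset.mem_insert.1 hx' with h | h
      · have := hydeg σ' hσ'
        rw [← h] at this
        omega
      · exact h
    have hA := (hstar σ hσ x hx.2).eq hd (hstar σ' hσ' x hxσ') (Finset.mem_insert_of_mem hx.2)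
      (Finset.mem_insert_of_mem hx.2)
    have hyy : y σ = y σ' := by
      have : y σ ∈ insert (y σ') σ' := hA ▸ Finset.mem_insert_self _ _
      rcases Finset.mem_insert.1 this with h | h
      · exact h
      · have h₁ := (hmem σ' hσ').2 _ h
        have h₂ := hydeg σ hσ
        omega
    rw [← Finset.erase_insert (hy σ hσ), ← Finset.erase_insert (hy σ' hσ'), hA, hyy]

/-- A minimal bad core has fewer vertices than members, by a factor bounded away from `1`: the
degrees have sum `(d + 1) |T|` and are at least `d + 1`, and a positive fraction of this sum comes
from vertices of larger degree. -/
theorem IsMinimalBadCore.card_vertices_le (hT : IsMinimalBadCore d T) (hd : 2 ≤ d) :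
    2 * (d + 1) * (d + 2) * (T.biUnion id).card + T.card ≤ 2 * (d + 1) * (d + 2) * T.card := by
  classical
  set W := T.biUnion id with hW
  have hWT : ∀ σ ∈ T, σ ⊆ W := fun σ hσ => Finset.subset_biUnion_of_mem id hσ
  have hsum : ∑ x ∈ W, vertexDegree T x = (d + 1) * T.card := by
    simp only [vertexDegree, Finset.card_filter]
    rw [Finset.sum_comm, mul_comm, ← smul_eq_mul, ← Finset.sum_const]
    refine Finset.sum_congr rfl fun σ hσ => ?_
    rw [← Finset.card_filter, ← (hT.isCore σ hσ).1]
    congr 1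
    ext x
    simp only [Finset.mem_filter]
    exact ⟨fun h => h.2, fun h => ⟨hWT σ hσ h, h⟩⟩
  have hheavy : (T.filter fun σ => ∃ x ∈ σ, d + 2 ≤ vertexDegree T x).card ≤
      ∑ x ∈ W, if d + 2 ≤ vertexDegree T x then vertexDegree T x else 0 := by
    rw [← Finset.sum_filter]
    refine (Finset.card_le_card ?_).trans Finset.card_biUnion_le
    intro σ hσ
    rw [Finset.mem_filter] at hσ
    obtain ⟨hσ, x, hx, hdeg⟩ := hσ
    exact Finset.mem_biUnion.2 ⟨x, Finset.mem_filter.2 ⟨hWT σ hσ hx, hdeg⟩,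
      Finset.mem_filter.2 ⟨hσ, hx⟩⟩
  have hpt : ∀ x ∈ W, (d + 1) * (d + 2) +
      (if d + 2 ≤ vertexDegree T x then vertexDegree T x else 0) ≤
        (d + 2) * vertexDegree T x := by
    intro x hx
    obtain ⟨σ, hσ, hxσ⟩ := Finset.mem_biUnion.1 hx
    have h₁ := (hT.isCore.le_vertexDegree hd hσ hxσ).1
    split_ifs with h
    · nlinarith
    · nlinarith
  have hfin := Finset.sum_le_sum hpt
  rw [Finset.sum_add_distrib, Finset.sum_const, ← Finset.mul_sum, hsum, smul_eq_mul] at hfin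
  have h2 := hT.card_le_two_mul hd
  nlinarith

end Degree

/-! ### Heavy sets and light facets -/

section LightFacets

variable {V : Type*} {d : ℕ}

open scoped Classical in
/-- The `d`-subsets of `σ` without heavy subsets. -/
noncomputable def lightFacets (d : ℕ) (H : Finset V → Prop) (σ : Finset V) : Finset (Finset V) :=
  {τ ∈ σ.powersetCard d | ∀ ρ ⊆ τ, ¬ H ρ}

open scoped Classical in
theorem mem_lightFacets {H : Finset V → Prop} {σ τ : Finset V} :
    τ ∈ lightFacets d H σ ↔ (τ ⊆ σ ∧ τ.card = d) ∧ ∀ ρ ⊆ τ, ¬ H ρ := by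
  rw [lightFacets, Finset.mem_filter, Finset.mem_powersetCard]

theorem card_shadow_le [DecidableEq V] {T : Finset (Finset V)} (hT : ∀ σ ∈ T, σ.card = d + 1) :
    (T.shadow).card ≤ (d + 1) * T.card := by
  have : T.shadow = T.biUnion fun σ => σ.image (σ.erase ·) := by
    ext τ
    simp [Finset.mem_shadow_iff]
  rw [this, mul_comm]
  exact Finset.card_biUnion_le_card_mul _ _ _ fun σ hσ => Finset.card_image_le.trans (hT σ hσ).le

end LightFacets

section Heavy

variable {V : Type*} [Fintype V] [DecidableEq V] {d : ℕ}

/-- The sets that can be extended to a member of `X` by at least `t` different vertices. -/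
noncomputable def heavier (t : ℝ) (X : Finset (Finset V)) : Finset (Finset V) :=
  {A | t ≤ ((Finset.univ.filter fun u => u ∉ A ∧ insert u A ∈ X).card : ℝ)}

/-- The heavy sets of level `k` over a family `X`, which itself is level `0`: a set belongs to
level `k + 1` if a proportion of at least `ε ^ 2 ^ (k + 1)` of all vertices extend it to a member of
level `k`. If `X` is defined by the threshold `ε`, then the threshold of each level is `ε` times the
product of those of all levels before it. -/
noncomputable def heavyLevel (ε : ℝ) (X : Finset (Finset V)) : ℕ → Finset (Finset V)
  | 0 => X
  | k + 1 => heavier (ε ^ 2 ^ (k + 1) * Fintype.card V) (heavyLevel ε X k)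

/-- A set is heavy if it belongs to one of the levels that are generated by `X`. -/
def IsHeavy (ε : ℝ) (X : Finset (Finset V)) (A : Finset V) : Prop := ∃ k, A ∈ heavyLevel ε X k

theorem exists_insert_mem_of_mem_heavier {t : ℝ} (ht : 0 < t) {X : Finset (Finset V)}
    {A : Finset V} (hA : A ∈ heavier t X) : ∃ u ∉ A, insert u A ∈ X := by
  rw [heavier, Finset.mem_filter] at hA
  have : 0 < (Finset.univ.filter fun u => u ∉ A ∧ insert u A ∈ X).card := by
    exact_mod_cast ht.trans_le hA.2
  obtain ⟨u, hu⟩ := Finset.card_pos.1 this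
  exact ⟨u, (Finset.mem_filter.1 hu).2⟩

theorem mul_card_heavier_le {t : ℝ} {X : Finset (Finset V)} {r : ℕ}
    (hX : ∀ B ∈ X, B.card ≤ r) : (heavier t X).card * t ≤ r * X.card := by
  have h₁ : ((heavier t X).card : ℝ) * t ≤
      ∑ A ∈ heavier t X, ((Finset.univ.filter fun u => u ∉ A ∧ insert u A ∈ X).card : ℝ) := by
    rw [← nsmul_eq_mul]
    exact Finset.card_nsmul_le_sum _ _ _ fun A hA => (Finset.mem_filter.1 hA).2
  have h₂ : ∑ A ∈ heavier t X, (Finset.univ.filter fun u => u ∉ A ∧ insert u A ∈ X).card ≤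
      ∑ B ∈ X, B.card := by
    rw [← Finset.card_sigma, ← Finset.card_sigma]
    refine Finset.card_le_card_of_injOn (fun p => ⟨insert p.2 p.1, p.2⟩) ?_ ?_
    · rintro ⟨A, u⟩ h
      simp only [Finset.coe_sigma, Set.mem_sigma_iff, Finset.mem_coe, Finset.mem_filter,
        Finset.mem_univ, true_and] at h ⊢
      exact ⟨h.2.2, Finset.mem_insert_self _ _⟩
    · rintro ⟨A, u⟩ h ⟨A', u'⟩ h' heq
      simp only [Finset.coe_sigma, Set.mem_sigma_iff, Finset.mem_coe, Finset.mem_filter,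
        Finset.mem_univ, true_and, Sigma.mk.injEq, heq_eq_eq] at h h' heq
      obtain ⟨h₁, rfl⟩ := heq
      rw [← Finset.erase_insert h.2.1, h₁, Finset.erase_insert h'.2.1]
  have h₃ : ∑ B ∈ X, B.card ≤ r * X.card := by
    rw [mul_comm, ← smul_eq_mul]
    exact Finset.sum_le_card_nsmul _ _ _ hX
  refine h₁.trans ?_
  exact_mod_cast h₂.trans h₃

section Levels

variable [Nonempty V] {ε : ℝ} {X : Finset (Finset V)}

theorem card_of_mem_heavyLevel (hε : 0 < ε) (hX : ∀ A ∈ X, A.card + 1 = d) {k : ℕ} {A : Finset V}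
    (hA : A ∈ heavyLevel ε X k) : A.card + k + 1 = d := by
  have hV : (0 : ℝ) < Fintype.card V := by exact_mod_cast Fintype.card_pos
  induction k generalizing A with
  | zero => exact hX A hA
  | succ k ih =>
    obtain ⟨u, hu, h⟩ := exists_insert_mem_of_mem_heavier (by positivity) hA
    have := ih h
    rw [Finset.card_insert_of_notMem hu] at this
    omega

theorem IsHeavy.card_lt (hε : 0 < ε) (hX : ∀ A ∈ X, A.card + 1 = d) {A : Finset V}
    (hA : IsHeavy ε X A) : A.card < d := by
  obtain ⟨k, hk⟩ := hA
  have := card_of_mem_heavyLevel hε hX hk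
  omega

theorem card_heavyLevel_mul_le (hε : 0 < ε) (hX : ∀ A ∈ X, A.card + 1 = d) {B : ℝ}
    (hB : X.card * (ε * Fintype.card V) ≤ B) (k : ℕ) :
    (heavyLevel ε X k).card * (ε ^ (2 ^ (k + 1) - 1) * (Fintype.card V : ℝ) ^ (k + 1)) ≤
      d ^ k * B := by
  induction k with
  | zero => simpa [heavyLevel] using hB
  | succ k ih =>
    have hstep : ((heavyLevel ε X (k + 1)).card : ℝ) * (ε ^ 2 ^ (k + 1) * Fintype.card V) ≤
        d * (heavyLevel ε X k).card := mul_card_heavier_le fun A hA => by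
      have := card_of_mem_heavyLevel hε hX hA
      omega
    have hpow : 2 ^ (k + 1 + 1) - 1 = 2 ^ (k + 1) + (2 ^ (k + 1) - 1) := by
      have : 1 ≤ 2 ^ (k + 1) := Nat.one_le_two_pow
      rw [pow_succ 2 (k + 1)]
      omega
    rw [hpow]
    calc ((heavyLevel ε X (k + 1)).card : ℝ) *
          (ε ^ (2 ^ (k + 1) + (2 ^ (k + 1) - 1)) * (Fintype.card V : ℝ) ^ (k + 1 + 1))
        = (((heavyLevel ε X (k + 1)).card : ℝ) * (ε ^ 2 ^ (k + 1) * Fintype.card V)) *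
          (ε ^ (2 ^ (k + 1) - 1) * (Fintype.card V : ℝ) ^ (k + 1)) := by
          rw [pow_add, pow_succ (Fintype.card V : ℝ) (k + 1)]; ring
      _ ≤ (d * (heavyLevel ε X k).card) *
          (ε ^ (2 ^ (k + 1) - 1) * (Fintype.card V : ℝ) ^ (k + 1)) := by gcongr
      _ = d * ((heavyLevel ε X k).card *
          (ε ^ (2 ^ (k + 1) - 1) * (Fintype.card V : ℝ) ^ (k + 1))) := by ring
      _ ≤ d * (d ^ k * B) := by gcongr
      _ = d ^ (k + 1) * B := by ring

theorem card_heavy_extensions_le (hε : 0 < ε) (hε₁ : ε ≤ 1) (hX : ∀ A ∈ X, A.card + 1 = d)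
    {ρ : Finset V} (hρ : ¬ IsHeavy ε X ρ) {k : ℕ} (hk : ρ.card + k + 2 ≤ d)
    [DecidablePred fun u => u ∉ ρ ∧ IsHeavy ε X (insert u ρ)] :
    ((Finset.univ.filter fun u => u ∉ ρ ∧ IsHeavy ε X (insert u ρ)).card : ℝ) ≤
      ε ^ 2 ^ (k + 1) * Fintype.card V := by
  obtain ⟨j, hj⟩ : ∃ j, ρ.card + j + 2 = d := ⟨d - 2 - ρ.card, by omega⟩
  have hkj : k ≤ j := by omega
  have h₁ : ρ ∉ heavyLevel ε X (j + 1) := fun h => hρ ⟨_, h⟩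
  rw [heavyLevel, heavier, Finset.mem_filter] at h₁
  simp only [Finset.mem_univ, true_and, not_le] at h₁
  calc ((Finset.univ.filter fun u => u ∉ ρ ∧ IsHeavy ε X (insert u ρ)).card : ℝ)
      ≤ ((Finset.univ.filter fun u => u ∉ ρ ∧ insert u ρ ∈ heavyLevel ε X j).card : ℝ) := by
        refine Nat.cast_le.2 (Finset.card_le_card fun u hu => ?_)
        rw [Finset.mem_filter] at hu ⊢
        obtain ⟨hu, hun, i, hi⟩ := hu
        have := card_of_mem_heavyLevel hε hX hi
        rw [Finset.card_insert_of_notMem hun] at this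
        obtain rfl : i = j := by omega
        exact ⟨hu, hun, hi⟩
    _ ≤ ε ^ 2 ^ (j + 1) * Fintype.card V := h₁.le
    _ ≤ ε ^ 2 ^ (k + 1) * Fintype.card V := by
        gcongr ?_ * _
        exact pow_le_pow_of_le_one hε.le hε₁ (Nat.pow_le_pow_right (by norm_num) (by omega))

end Levels

/-- The supersets of `A` with `k` additional elements are at most `|V| ^ k` in number. -/
theorem card_supersets_le (A : Finset V) (k : ℕ) :
    (Finset.univ.filter fun Q => A ⊆ Q ∧ Q.card = A.card + k).card ≤ Fintype.card V ^ k := by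
  calc (Finset.univ.filter fun Q => A ⊆ Q ∧ Q.card = A.card + k).card
      ≤ ((Finset.univ : Finset V).powersetCard k).card := by
        refine Finset.card_le_card_of_injOn (· \ A) (fun Q hQ => ?_) (fun Q hQ Q' hQ' h => ?_)
        · simp only [Finset.coe_filter, Finset.mem_univ, true_and, Set.mem_ofPred_eq] at hQ
          simp only [Finset.mem_coe, Finset.mem_powersetCard, Finset.subset_univ, true_and]
          rw [Finset.card_sdiff_of_subset hQ.1, hQ.2]
          omega
        · simp only [Finset.coe_filter, Finset.mem_univ, true_and, Set.mem_ofPred_eq] at hQ hQ'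
          simp only at h
          rw [← Finset.sdiff_union_of_subset hQ.1, h, Finset.sdiff_union_of_subset hQ'.1]
    _ ≤ Fintype.card V ^ k := by
        rw [Finset.card_powersetCard, Finset.card_univ]
        exact Nat.choose_le_pow _ _

/-- A set is tangled if it contains a heavy set `A` together with a heavy set `insert u D` that is
not larger than `A`, where `u ∉ A` and `D` is not heavy. -/
def IsTangled (H : Finset V → Prop) (τ : Finset V) : Prop :=
  ∃ A ⊆ τ, H A ∧ ∃ u ∈ τ, u ∉ A ∧ ∃ D ⊆ τ, u ∉ D ∧ D.card < A.card ∧ ¬ H D ∧ H (insert u D)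

open scoped Classical in
/-- There are few tangled `d`-sets: given `A` and all elements of `τ` but `u`, only few choices
of `u` make `insert u D` heavy, and since `D` is smaller than `A`, the threshold that governs this
number is small compared with the number of choices for `A`. -/
theorem card_isTangled_le [Nonempty V] {ε : ℝ} {X : Finset (Finset V)} (hε : 0 < ε) (hε₁ : ε ≤ 1)
    (hX : ∀ A ∈ X, A.card + 1 = d) {B : ℝ} (hB : X.card * (ε * Fintype.card V) ≤ B) :
    ((Finset.univ.filter fun τ : Finset V => τ.card = d ∧ IsTangled (IsHeavy ε X) τ).card : ℝ) ≤
      d * (2 ^ d * d ^ d * ε * B) := by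
  have hB₀ : 0 ≤ B := le_trans (by positivity) hB
  set H := IsHeavy ε X with hH
  have hsub : (Finset.univ.filter fun τ : Finset V => τ.card = d ∧ IsTangled H τ) ⊆
      (Finset.range d).biUnion fun k => (heavyLevel ε X k).biUnion fun A =>
        (Finset.univ.filter fun Q => A ⊆ Q ∧ Q.card = A.card + k).biUnion fun Q =>
          (Q.powerset.filter fun D => ¬ H D ∧ D.card + k + 2 ≤ d).biUnion fun D =>
            (Finset.univ.filter fun u => u ∉ D ∧ H (insert u D)).image (insert · Q) := by
    intro τ hτ
    rw [Finset.mem_filter] at hτ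
    obtain ⟨-, hτ, A, hA, ⟨k, hk⟩, u, hu, huA, D, hD, huD, hDA, hDH, hDH'⟩ := hτ
    have hAk := card_of_mem_heavyLevel hε hX hk
    simp only [Finset.mem_biUnion, Finset.mem_range, Finset.mem_filter, Finset.mem_univ, true_and,
      Finset.mem_powerset, Finset.mem_image]
    refine ⟨k, by omega, A, hk, τ.erase u, ⟨fun x hx => ?_, ?_⟩, D, ⟨fun x hx => ?_, hDH, by omega⟩,
      u, ⟨huD, hDH'⟩, Finset.insert_erase hu⟩
    · exact Finset.mem_erase.2 ⟨fun h => huA (h ▸ hx), hA hx⟩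
    · rw [Finset.card_erase_of_mem hu]; omega
    · exact Finset.mem_erase.2 ⟨fun h => huD (h ▸ hx), hD hx⟩
  have hterm : ∀ k ∈ Finset.range d, (((heavyLevel ε X k).biUnion fun A =>
        (Finset.univ.filter fun Q => A ⊆ Q ∧ Q.card = A.card + k).biUnion fun Q =>
          (Q.powerset.filter fun D => ¬ H D ∧ D.card + k + 2 ≤ d).biUnion fun D =>
            (Finset.univ.filter fun u => u ∉ D ∧ H (insert u D)).image (insert · Q)).card : ℝ) ≤
      2 ^ d * d ^ d * ε * B := by
    intro k hk
    rw [Finset.mem_range] at hk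
    set N : ℝ := (Fintype.card V : ℝ) with hN
    have hbound : ∀ (ι : Type _) (s : Finset ι) (f : ι → Finset (Finset V)) (b : ℝ),
        (∀ i ∈ s, ((f i).card : ℝ) ≤ b) → ((s.biUnion f).card : ℝ) ≤ s.card * b := by
      intro ι s f b h
      calc ((s.biUnion f).card : ℝ) ≤ ∑ i ∈ s, ((f i).card : ℝ) := by
            exact_mod_cast Finset.card_biUnion_le
        _ ≤ s.card * b := by
            rw [← nsmul_eq_mul]; exact Finset.sum_le_card_nsmul _ _ _ h
    calc (_ : ℝ) ≤ (heavyLevel ε X k).card * (N ^ k * (2 ^ d * (ε ^ 2 ^ (k + 1) * N))) := by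
          refine hbound _ _ _ _ fun A hA => ?_
          have hAk := card_of_mem_heavyLevel hε hX hA
          refine (hbound _ _ _ (2 ^ d * (ε ^ 2 ^ (k + 1) * N)) fun Q hQ => ?_).trans ?_
          · refine (hbound _ _ _ (ε ^ 2 ^ (k + 1) * N) fun D hD => ?_).trans ?_
            · refine le_trans (Nat.cast_le.2 Finset.card_image_le) ?_
              exact card_heavy_extensions_le hε hε₁ hX (Finset.mem_filter.1 hD).2.1
                (Finset.mem_filter.1 hD).2.2
            · gcongr
              have h₁ : (Q.powerset.filter fun D => ¬ H D ∧ D.card + k + 2 ≤ d).card ≤ 2 ^ d := by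
                refine (Finset.card_filter_le _ _).trans ?_
                rw [Finset.card_powerset]
                refine Nat.pow_le_pow_right (by norm_num) ?_
                have := (Finset.mem_filter.1 hQ).2.2
                omega
              exact_mod_cast h₁
          · gcongr
            rw [hN]
            exact_mod_cast card_supersets_le A k
      _ = 2 ^ d * ε * ((heavyLevel ε X k).card * (ε ^ (2 ^ (k + 1) - 1) * N ^ (k + 1))) := by
          have : ε ^ 2 ^ (k + 1) = ε * ε ^ (2 ^ (k + 1) - 1) := by
            rw [← pow_succ', Nat.sub_add_cancel Nat.one_le_two_pow]
          rw [this]; ring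
      _ ≤ 2 ^ d * ε * (d ^ k * B) := by
          exact mul_le_mul_of_nonneg_left (card_heavyLevel_mul_le hε hX hB k) (by positivity)
      _ ≤ 2 ^ d * ε * (d ^ d * B) := by
          gcongr
          · exact_mod_cast (by omega : 1 ≤ d)
      _ = 2 ^ d * d ^ d * ε * B := by ring
  calc _ ≤ ∑ k ∈ Finset.range d, _ := by
        refine le_trans (Nat.cast_le.2 ((Finset.card_le_card hsub).trans
          Finset.card_biUnion_le)) ?_
        rw [Nat.cast_sum]
    _ ≤ ∑ k ∈ Finset.range d, 2 ^ d * d ^ d * ε * B := Finset.sum_le_sum hterm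
    _ = d * (2 ^ d * d ^ d * ε * B) := by
        rw [Finset.sum_const, Finset.card_range, nsmul_eq_mul]

/-! ### Extending a family at a `d`-set -/

open scoped Classical in
/-- The vertices `u` that extend some non-heavy subset of `τ` to a heavy set or to a member of the
shadow of `P`. -/
noncomputable def savingVertices (H : Finset V → Prop) (P : Finset (Finset V)) (τ : Finset V) :
    Finset V :=
  {u | u ∉ τ ∧ ∃ ρ ⊆ τ, ¬ H ρ ∧ (H (insert u ρ) ∨ insert u ρ ∈ P.shadow)}

/-- If an untangled `d`-set `τ` is extended by a vertex that is not saving, then the light facets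
of the new `(d+1)`-set are all new, except for `τ` itself if `τ` is light; and there is at least one
new one, and at least two if `τ` is light. -/
theorem card_lightFacets_lt (hd : 2 ≤ d) {H : Finset V → Prop} (h₀ : ¬ H ∅)
    {P : Finset (Finset V)} {τ : Finset V} (hτ : τ.card = d)
    (htan : ¬ IsTangled H τ) {u : V} (huτ : u ∉ τ) (hu : u ∉ savingVertices H P τ) :
    (lightFacets d H (insert u τ)).card + 1 ≤
      2 * (lightFacets d H (insert u τ) \ P.shadow).card := by
  classical
  have hns : ∀ ρ ⊆ τ, ¬ H ρ → ¬ H (insert u ρ) ∧ insert u ρ ∉ P.shadow := by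
    intro ρ hρ hρH
    by_contra hcon
    refine hu ?_
    rw [savingVertices, Finset.mem_filter]
    exact ⟨Finset.mem_univ _, huτ, ρ, hρ, hρH, by tauto⟩
  have hnew : ∀ w ∈ τ, (∀ ρ ⊆ τ.erase w, ¬ H ρ) →
      insert u (τ.erase w) ∈ lightFacets d H (insert u τ) \ P.shadow := by
    intro w hw hl
    have hsub := Finset.erase_subset w τ
    rw [Finset.mem_sdiff, mem_lightFacets]
    refine ⟨⟨⟨Finset.insert_subset_insert _ hsub, ?_⟩, fun ρ hρ => ?_⟩,
      (hns _ hsub (hl _ subset_rfl)).2⟩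
    · rw [Finset.card_insert_of_notMem (fun h => huτ (hsub h)), Finset.card_erase_of_mem hw]
      omega
    · by_cases huρ : u ∈ ρ
      · have h₁ : ρ.erase u ⊆ τ.erase w := fun x hx => by
          rw [Finset.mem_erase] at hx
          exact (Finset.mem_insert.1 (hρ hx.2)).resolve_left hx.1
        rw [← Finset.insert_erase huρ]
        exact (hns _ (h₁.trans hsub) (hl _ h₁)).1
      · exact hl ρ fun x hx =>
          (Finset.mem_insert.1 (hρ hx)).resolve_left fun h => huρ (h ▸ hx)
  have hold : ∀ ρ ∈ lightFacets d H (insert u τ), ρ ≠ τ →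
      ρ ∈ lightFacets d H (insert u τ) \ P.shadow := by
    intro ρ hρ hne
    refine Finset.mem_sdiff.2 ⟨hρ, ?_⟩
    rw [mem_lightFacets] at hρ
    have huρ : u ∈ ρ := by
      by_contra huρ
      refine hne (Finset.eq_of_subset_of_card_le (fun x hx => ?_) (by omega))
      exact (Finset.mem_insert.1 (hρ.1.1 hx)).resolve_left fun h => huρ (h ▸ hx)
    rw [← Finset.insert_erase huρ]
    refine (hns _ (fun x hx => ?_) (hρ.2 _ (Finset.erase_subset _ _))).2
    rw [Finset.mem_erase] at hx
    exact (Finset.mem_insert.1 (hρ.1.1 hx.2)).resolve_left hx.1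
  by_cases hl : ∀ ρ ⊆ τ, ¬ H ρ
  · have h₁ : (lightFacets d H (insert u τ)).card ≤
        (lightFacets d H (insert u τ) \ P.shadow).card + 1 := by
      refine (Finset.card_le_card (fun ρ hρ => ?_)).trans (Finset.card_insert_le τ _)
      by_cases h : ρ = τ
      · exact h ▸ Finset.mem_insert_self _ _
      · exact Finset.mem_insert_of_mem (hold ρ hρ h)
    have h₂ : τ.card ≤ (lightFacets d H (insert u τ) \ P.shadow).card := by
      refine Finset.card_le_card_of_injOn (fun w => insert u (τ.erase w)) (fun w hw => ?_) ?_
      · exact hnew w hw fun ρ hρ => hl ρ (hρ.trans (Finset.erase_subset _ _))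
      · intro w hw w' hw' heq
        simp only at heq
        rw [Finset.mem_coe] at hw hw'
        by_contra hne
        have : w ∈ insert u (τ.erase w) := by
          rw [heq]
          exact Finset.mem_insert_of_mem (Finset.mem_erase.2 ⟨hne, hw⟩)
        rcases Finset.mem_insert.1 this with h | h
        · exact huτ (h ▸ hw)
        · simp at h
    omega
  · have h₁ : lightFacets d H (insert u τ) ⊆ lightFacets d H (insert u τ) \ P.shadow := by
      intro ρ hρ
      exact hold ρ hρ fun h => hl (h ▸ (mem_lightFacets.1 hρ).2)
    -- If `M` is a smallest heavy subset of `τ`, every heavy subset of `τ` contains `M`, as `τ` is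
    -- not tangled.
    obtain ⟨M, hM, hmin⟩ := Finset.exists_min_image (τ.powerset.filter H) Finset.card (by
      push Not at hl
      obtain ⟨ρ, hρ, hρH⟩ := hl
      exact ⟨ρ, Finset.mem_filter.2 ⟨Finset.mem_powerset.2 hρ, hρH⟩⟩)
    rw [Finset.mem_filter, Finset.mem_powerset] at hM
    obtain ⟨w, hw⟩ : M.Nonempty := by
      rw [Finset.nonempty_iff_ne_empty]
      rintro rfl
      exact h₀ hM.2
    have h₂ := hnew w (hM.1 hw) fun A hA hAH => htan ⟨A, hA.trans (Finset.erase_subset _ _), hAH,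
      w, hM.1 hw, fun h => (Finset.mem_erase.1 (hA h)).1 rfl, M.erase w,
      (Finset.erase_subset _ _).trans hM.1, Finset.notMem_erase _ _, ?_, ?_, ?_⟩
    · have h₃ := Finset.card_le_card h₁
      have h₄ := Finset.card_pos.2 ⟨_, h₂⟩
      omega
    · have h₃ := hmin A (Finset.mem_filter.2
        ⟨Finset.mem_powerset.2 (hA.trans (Finset.erase_subset _ _)), hAH⟩)
      exact (Finset.card_erase_lt_of_mem hw).trans_le h₃
    · intro h
      have h₃ := hmin (M.erase w) (Finset.mem_filter.2
        ⟨Finset.mem_powerset.2 ((Finset.erase_subset _ _).trans hM.1), h⟩)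
      exact absurd (Finset.card_erase_lt_of_mem hw) (not_lt.2 h₃)
    · rw [Finset.insert_erase hw]
      exact hM.2

/-- The family of heavy `(d-1)`-sets of `T`: those that extend to many members of its shadow. -/
noncomputable def heavyBase (ε : ℝ) (T : Finset (Finset V)) : Finset (Finset V) :=
  heavier (ε * Fintype.card V) (T.shadow)

theorem card_of_mem_heavyBase [Nonempty V] {ε : ℝ} (hε : 0 < ε) {T : Finset (Finset V)}
    (hT : ∀ σ ∈ T, σ.card = d + 1) {A : Finset V} (hA : A ∈ heavyBase ε T) : A.card + 1 = d := by
  have hV : (0 : ℝ) < Fintype.card V := by exact_mod_cast Fintype.card_pos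
  obtain ⟨u, hu, h⟩ := exists_insert_mem_of_mem_heavier (by positivity) hA
  have : (insert u A).card = d := by
    obtain ⟨s, hs, -, hc⟩ := Finset.mem_shadow_iff_exists_mem_card_add_one.1 h
    have := hT s hs
    omega
  rwa [Finset.card_insert_of_notMem hu] at this

theorem card_heavyBase_mul_le {ε : ℝ} {T : Finset (Finset V)}
    (hT : ∀ σ ∈ T, σ.card = d + 1) :
    (heavyBase ε T).card * (ε * Fintype.card V) ≤ d * ((d + 1) * T.card) := by
  refine (mul_card_heavier_le (r := d) fun B hB => ?_).trans ?_
  · obtain ⟨s, hs, -, hc⟩ := Finset.mem_shadow_iff_exists_mem_card_add_one.1 hB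
    have := hT s hs
    omega
  · gcongr
    exact_mod_cast card_shadow_le hT

/-- A small family has no heavy empty set. -/
theorem not_isHeavy_empty [Nonempty V] {ε : ℝ} (hε : 0 < ε) (hd : 1 ≤ d) {T : Finset (Finset V)}
    (hT : ∀ σ ∈ T, σ.card = d + 1)
    (hcard : d ^ (d - 1) * (d * ((d + 1) * T.card)) <
      ε ^ (2 ^ d - 1) * (Fintype.card V : ℝ) ^ d) :
    ¬ IsHeavy ε (heavyBase ε T) ∅ := by
  rintro ⟨k, hk⟩
  have hkd := card_of_mem_heavyLevel hε (fun A => card_of_mem_heavyBase hε hT) hk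
  rw [Finset.card_empty] at hkd
  have h := card_heavyLevel_mul_le hε (fun A => card_of_mem_heavyBase hε hT)
    (card_heavyBase_mul_le (ε := ε) hT) k
  have h₁ : (1 : ℝ) ≤ (heavyLevel ε (heavyBase ε T) k).card := by
    exact_mod_cast Finset.card_pos.2 ⟨_, hk⟩
  have hk1 : k + 1 = d := by omega
  have hkd' : k = d - 1 := by omega
  rw [hk1, hkd'] at h
  rw [hkd'] at h₁
  have h₂ : (0 : ℝ) ≤ ε ^ (2 ^ d - 1) * (Fintype.card V : ℝ) ^ d := by positivity
  nlinarith [mul_le_mul_of_nonneg_right h₁ h₂]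

/-- Relative to the heavy sets of a family that contains `P`, there are few saving vertices. -/
theorem card_savingVertices_le [Nonempty V] {ε : ℝ} (hε : 0 < ε) (hε₁ : ε ≤ 1)
    {T P : Finset (Finset V)} (hT : ∀ σ ∈ T, σ.card = d + 1) (hPT : P ⊆ T) {τ : Finset V}
    (hτ : τ.card = d) :
    ((savingVertices (IsHeavy ε (heavyBase ε T)) P τ).card : ℝ) ≤
      2 ^ d * (ε * Fintype.card V) := by
  classical
  set H := IsHeavy ε (heavyBase ε T) with hH
  have hX : ∀ A ∈ heavyBase ε T, A.card + 1 = d := fun A => card_of_mem_heavyBase hε hT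
  have hsh : ∀ A ∈ P.shadow, A.card = d := by
    intro A hA
    obtain ⟨s, hs, -, hc⟩ := Finset.mem_shadow_iff_exists_mem_card_add_one.1 hA
    have := hT s (hPT hs)
    omega
  have hsub : savingVertices H P τ ⊆ (τ.powerset.filter fun ρ => ¬ H ρ).biUnion fun ρ =>
      Finset.univ.filter fun u => u ∉ ρ ∧ (H (insert u ρ) ∨ insert u ρ ∈ P.shadow) := by
    intro u hu
    rw [savingVertices, Finset.mem_filter] at hu
    obtain ⟨-, huτ, ρ, hρ, hρH, h⟩ := hu
    exact Finset.mem_biUnion.2 ⟨ρ, Finset.mem_filter.2 ⟨Finset.mem_powerset.2 hρ, hρH⟩,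
      Finset.mem_filter.2 ⟨Finset.mem_univ _, fun h' => huτ (hρ h'), h⟩⟩
  have hterm : ∀ ρ ∈ τ.powerset.filter fun ρ => ¬ H ρ,
      ((Finset.univ.filter fun u => u ∉ ρ ∧ (H (insert u ρ) ∨ insert u ρ ∈ P.shadow)).card : ℝ) ≤
        ε * Fintype.card V := by
    intro ρ hρ
    rw [Finset.mem_filter, Finset.mem_powerset] at hρ
    have hρd := Finset.card_le_card hρ.1
    rcases (by omega : ρ.card + 0 + 2 ≤ d ∨ d ≤ ρ.card + 1) with h | h
    · calc (_ : ℝ) ≤ ((Finset.univ.filter fun u => u ∉ ρ ∧ H (insert u ρ)).card : ℝ) := by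
            refine Nat.cast_le.2 (Finset.card_le_card fun u hu => ?_)
            rw [Finset.mem_filter] at hu ⊢
            refine ⟨hu.1, hu.2.1, hu.2.2.resolve_right fun h' => ?_⟩
            have := hsh _ h'
            rw [Finset.card_insert_of_notMem hu.2.1] at this
            omega
        _ ≤ ε ^ 2 ^ (0 + 1) * Fintype.card V := card_heavy_extensions_le hε hε₁ hX hρ.2 h
        _ ≤ ε * Fintype.card V := by
            gcongr
            exact pow_le_of_le_one hε.le hε₁ (by norm_num)
    · have h₁ : ρ ∉ heavyBase ε T := fun h' => hρ.2 ⟨0, h'⟩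
      rw [heavyBase, heavier, Finset.mem_filter] at h₁
      simp only [Finset.mem_univ, true_and, not_le] at h₁
      refine le_trans (Nat.cast_le.2 (Finset.card_le_card fun u hu => ?_)) h₁.le
      rw [Finset.mem_filter] at hu ⊢
      refine ⟨hu.1, hu.2.1, ?_⟩
      rcases hu.2.2 with h' | h'
      · have := h'.card_lt hε hX
        rw [Finset.card_insert_of_notMem hu.2.1] at this
        omega
      · exact Finset.shadow_mono hPT h'
  calc ((savingVertices H P τ).card : ℝ)
      ≤ ∑ ρ ∈ τ.powerset.filter fun ρ => ¬ H ρ,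
        ((Finset.univ.filter fun u => u ∉ ρ ∧ (H (insert u ρ) ∨ insert u ρ ∈ P.shadow)).card : ℝ) := by
        exact_mod_cast (Finset.card_le_card hsub).trans Finset.card_biUnion_le
    _ ≤ (τ.powerset.filter fun ρ => ¬ H ρ).card * (ε * Fintype.card V) := by
        rw [← nsmul_eq_mul]; exact Finset.sum_le_card_nsmul _ _ _ hterm
    _ ≤ 2 ^ d * (ε * Fintype.card V) := by
        gcongr
        have : (τ.powerset.filter fun ρ => ¬ H ρ).card ≤ 2 ^ d := by
          refine (Finset.card_filter_le _ _).trans ?_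
          rw [Finset.card_powerset, hτ]
        exact_mod_cast this

end Heavy

/-! ### Exploring a core from a seed -/

section Explore

variable {V : Type*} {d : ℕ}

/-- The `d`-set `τ` is contained in exactly one member of `P`. -/
def IsFreeIn (d : ℕ) (P : Finset (Finset V)) (τ : Finset V) : Prop :=
  τ.card = d ∧ ∃ σ ∈ P, τ ⊆ σ ∧ ∀ σ' ∈ P, τ ⊆ σ' → σ' = σ

open scoped Classical in
/-- A chosen free `d`-set of `P`; it is the empty set if there is none. -/
noncomputable def freeSet (d : ℕ) (P : Finset (Finset V)) : Finset V :=
  if h : ∃ τ, IsFreeIn d P τ then h.choose else ∅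

theorem isFreeIn_freeSet {P : Finset (Finset V)} (hP : ∀ σ ∈ P, σ.card = d + 1)
    (hcore : ¬ IsCore d P) : IsFreeIn d P (freeSet d P) := by
  have h : ∃ τ, IsFreeIn d P τ := by
    by_contra! hno
    refine hcore fun σ hσ => ⟨hP σ hσ, fun τ hτ hτc => ?_⟩
    by_contra! hcon
    refine hno τ ⟨hτc, σ, hσ, hτ, fun σ' hσ' hτ' => ?_⟩
    by_contra hne
    exact hcon σ' hσ' hne hτ'
  rw [freeSet, dif_pos h]
  exact h.choose_spec

theorem card_lightFacets_le {H : Finset V → Prop} {σ : Finset V} (hσ : σ.card = d + 1) :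
    (lightFacets d H σ).card ≤ d + 1 := by
  classical
  rw [lightFacets]
  refine (Finset.card_filter_le _ _).trans ?_
  rw [Finset.card_powersetCard, hσ, Nat.choose_succ_self_right]

variable [DecidableEq V]

open scoped Classical in
/-- The tangled `d`-sets that are not contained in two members of `P`. They are the ones that can
still become the set at which `P` is extended. -/
noncomputable def openTangled [Fintype V] (d : ℕ) (H : Finset V → Prop) (P : Finset (Finset V)) :
    Finset (Finset V) :=
  {τ | (τ.card = d ∧ IsTangled H τ) ∧ ¬ ∃ σ ∈ P, ∃ σ' ∈ P, σ ≠ σ' ∧ τ ⊆ σ ∧ τ ⊆ σ'}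

/-- The number of pairs of a member of `P` and a light facet of it, minus twice the number of light
facets of members of `P`. In a core it is nonnegative. -/
noncomputable def lightExcess (d : ℕ) (H : Finset V → Prop) (P : Finset (Finset V)) : ℤ :=
  ∑ σ ∈ P, ((lightFacets d H σ).card : ℤ) - 2 * ((P.biUnion (lightFacets d H)).card : ℤ)

theorem IsCore.lightExcess_nonneg {T : Finset (Finset V)} (hT : IsCore d T)
    (H : Finset V → Prop) : 0 ≤ lightExcess d H T := by
  classical
  set L := T.biUnion (lightFacets d H) with hL
  have h₁ : ∑ σ ∈ T, (lightFacets d H σ).card =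
      ∑ τ ∈ L, (T.filter fun σ => τ ∈ lightFacets d H σ).card := by
    simp only [Finset.card_filter]
    rw [Finset.sum_comm]
    refine Finset.sum_congr rfl fun σ hσ => ?_
    rw [← Finset.card_filter]
    congr 1
    ext τ
    simp only [Finset.mem_filter]
    exact ⟨fun h => ⟨Finset.mem_biUnion.2 ⟨σ, hσ, h⟩, h⟩, fun h => h.2⟩
  have h₂ : L.card * 2 ≤ ∑ τ ∈ L, (T.filter fun σ => τ ∈ lightFacets d H σ).card := by
    rw [← smul_eq_mul]
    refine Finset.card_nsmul_le_sum _ _ _ fun τ hτ => ?_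
    obtain ⟨σ, hσ, hτσ⟩ := Finset.mem_biUnion.1 hτ
    have hτσ' := mem_lightFacets.1 hτσ
    obtain ⟨σ', hσ', hne, hτσ''⟩ := (hT σ hσ).2 τ hτσ'.1.1 hτσ'.1.2
    refine Finset.one_lt_card.2 ⟨σ, Finset.mem_filter.2 ⟨hσ, hτσ⟩, σ', Finset.mem_filter.2
      ⟨hσ', mem_lightFacets.2 ⟨⟨hτσ'', hτσ'.1.2⟩, hτσ'.2⟩⟩, hne.symm⟩
  rw [lightExcess, ← hL]
  have : ((L.card * 2 : ℕ) : ℤ) ≤ ((∑ σ ∈ T, (lightFacets d H σ).card : ℕ) : ℤ) := by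
    rw [h₁]; exact_mod_cast h₂
  push_cast at this
  linarith

theorem lightExcess_insert {H : Finset V → Prop} {P : Finset (Finset V)} {σ : Finset V}
    (hσ : σ ∉ P) : lightExcess d H (insert σ P) = lightExcess d H P + (lightFacets d H σ).card -
      2 * (lightFacets d H σ \ P.biUnion (lightFacets d H)).card := by
  rw [lightExcess, lightExcess, Finset.sum_insert hσ, Finset.biUnion_insert,
    ← Finset.sdiff_union_self_eq_union, Finset.card_union_of_disjoint Finset.sdiff_disjoint]
  push_cast
  ring

theorem lightExcess_le {H : Finset V → Prop} {P : Finset (Finset V)}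
    (hP : ∀ σ ∈ P, σ.card = d + 1) : lightExcess d H P ≤ (d + 1) * P.card := by
  have h : ∑ σ ∈ P, ((lightFacets d H σ).card : ℤ) ≤ P.card • ((d : ℤ) + 1) :=
    Finset.sum_le_card_nsmul _ _ _ fun σ hσ => by exact_mod_cast card_lightFacets_le (hP σ hσ)
  rw [nsmul_eq_mul] at h
  rw [lightExcess]
  have : (0 : ℤ) ≤ ((P.biUnion (lightFacets d H)).card : ℤ) := by positivity
  linarith

theorem biUnion_lightFacets_subset {H : Finset V → Prop} {P : Finset (Finset V)}
    (hP : ∀ σ ∈ P, σ.card = d + 1) : P.biUnion (lightFacets d H) ⊆ P.shadow := by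
  intro τ hτ
  obtain ⟨σ, hσ, hτσ⟩ := Finset.mem_biUnion.1 hτ
  rw [mem_lightFacets] at hτσ
  exact Finset.mem_shadow_iff_exists_mem_card_add_one.2
    ⟨σ, hσ, hτσ.1.1, by rw [hP σ hσ, hτσ.1.2]⟩

variable [Fintype V]

open scoped Classical in
/-- The families that arise from `P` when `k` times a set is added that contains the free `d`-set
of the family at hand, and in at least `s` of these steps the additional vertex is one of at most
`b` saving vertices. -/
noncomputable def explore (d : ℕ) (H : Finset V → Prop) (b : ℝ) :
    ℕ → ℕ → Finset (Finset V) → Finset (Finset (Finset V))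
  | 0, s, P => if s = 0 then {P} else ∅
  | k + 1, s, P =>
      (Finset.univ.biUnion fun u => explore d H b k s (insert (insert u (freeSet d P)) P)) ∪
      ((if ((savingVertices H P (freeSet d P)).card : ℝ) ≤ b then
        savingVertices H P (freeSet d P) else ∅).biUnion fun u =>
          explore d H b k (s - 1) (insert (insert u (freeSet d P)) P))

theorem card_explore_le (H : Finset V → Prop) {δ : ℝ} (hδ : 0 ≤ δ) (hδ₁ : δ ≤ 1) (k s : ℕ)
    (P : Finset (Finset V)) :
    ((explore d H (δ * Fintype.card V) k s P).card : ℝ) ≤ (2 * Fintype.card V) ^ k * δ ^ s := by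
  classical
  induction k generalizing s P with
  | zero =>
    rw [explore]
    split_ifs with h
    · simp [h]
    · simp; positivity
  | succ k ih =>
    rw [explore]
    set N : ℝ := (Fintype.card V : ℝ) with hN
    have hN₀ : 0 ≤ N := by positivity
    have hbound : ∀ (W : Finset V) (f : V → Finset (Finset (Finset V))) (c : ℝ),
        (∀ u ∈ W, ((f u).card : ℝ) ≤ c) → ((W.biUnion f).card : ℝ) ≤ W.card * c := by
      intro W f c h
      calc ((W.biUnion f).card : ℝ) ≤ ∑ u ∈ W, ((f u).card : ℝ) := by
            exact_mod_cast Finset.card_biUnion_le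
        _ ≤ W.card * c := by
            rw [← nsmul_eq_mul]; exact Finset.sum_le_card_nsmul _ _ _ h
    set S := (if ((savingVertices H P (freeSet d P)).card : ℝ) ≤ δ * N then
        savingVertices H P (freeSet d P) else ∅) with hS
    have hSc : (S.card : ℝ) ≤ δ * N := by
      rw [hS]
      split_ifs with h
      · exact h
      · simp; positivity
    have h₁ := hbound Finset.univ
      (fun u => explore d H (δ * N) k s (insert (insert u (freeSet d P)) P)) _
      (fun u _ => ih s _)
    have h₂ := hbound S
      (fun u => explore d H (δ * N) k (s - 1) (insert (insert u (freeSet d P)) P)) _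
      (fun u _ => ih (s - 1) _)
    rw [Finset.card_univ] at h₁
    have h₃ : δ * δ ^ (s - 1) ≤ δ ^ s := by
      rcases s with _ | s
      · simpa using hδ₁
      · rw [Nat.add_sub_cancel, ← pow_succ']
    calc (_ : ℝ) ≤ N * ((2 * N) ^ k * δ ^ s) + S.card * ((2 * N) ^ k * δ ^ (s - 1)) := by
          refine le_trans (Nat.cast_le.2 (Finset.card_union_le _ _)) ?_
          rw [Nat.cast_add]
          exact add_le_add h₁ h₂
      _ ≤ N * ((2 * N) ^ k * δ ^ s) + (δ * N) * ((2 * N) ^ k * δ ^ (s - 1)) := by gcongr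
      _ = N * ((2 * N) ^ k * δ ^ s) + N * (2 * N) ^ k * (δ * δ ^ (s - 1)) := by ring
      _ ≤ N * ((2 * N) ^ k * δ ^ s) + N * (2 * N) ^ k * δ ^ s := by gcongr
      _ = (2 * N) ^ (k + 1) * δ ^ s := by ring

/-- A core is reached from a seed by an exploration with many saving steps. Indeed, an
extension of an untangled free set by a vertex that is not saving lowers `lightExcess`, which
cannot become negative in the end, and each tangled set is extended at most once. The number `s` of
saving steps that are still required may be negative, so that it drops by exactly one in each saving
step. -/
theorem mem_explore (hd : 2 ≤ d) {H : Finset V → Prop} (h₀ : ¬ H ∅) {b : ℝ}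
    {I T : Finset (Finset V)} (hT : IsCore d T)
    (hI : ∀ P ⊆ T, I ⊆ P → IsCore d P → P = T)
    (hsav : ∀ P ⊆ T, ∀ τ : Finset V, τ.card = d → ((savingVertices H P τ).card : ℝ) ≤ b)
    (k : ℕ) (P : Finset (Finset V)) (s : ℤ) (hIP : I ⊆ P) (hPT : P ⊆ T)
    (hk : P.card + k = T.card)
    (hs : (d + 2) * s + lightExcess d H P + (d + 2) * (openTangled d H P).card ≤
      k + lightExcess d H T) : T ∈ explore d H b k s.toNat P := by
  classical
  induction k generalizing P s with
  | zero =>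
    obtain rfl : P = T := Finset.eq_of_subset_of_card_le hPT (by omega)
    have : s ≤ 0 := by
      by_contra! hpos
      have h₁ : (0 : ℤ) ≤ (d + 2) * ((openTangled d H P).card : ℤ) := by positivity
      have h₂ : (0 : ℤ) < (d + 2) * s := by positivity
      push_cast at hs
      linarith
    rw [explore, if_pos (Int.toNat_eq_zero.2 this)]
    exact Finset.mem_singleton_self _
  | succ k ih =>
    have hPc : ∀ σ ∈ P, σ.card = d + 1 := fun σ hσ => (hT σ (hPT hσ)).1
    have hncore : ¬ IsCore d P := by
      intro h
      have := hI P hPT hIP h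
      subst this
      omega
    obtain ⟨hτc, σ₀, hσ₀, hτσ₀, huniq⟩ := isFreeIn_freeSet hPc hncore
    rw [explore]
    set τ := freeSet d P with hτ
    obtain ⟨σ, hσT, hσne, hτσ⟩ := (hT σ₀ (hPT hσ₀)).2 τ hτσ₀ hτc
    have hσP : σ ∉ P := fun h => hσne (huniq σ h hτσ)
    have hσc := (hT σ hσT).1
    obtain ⟨u, huσ, huτ⟩ : ∃ u ∈ σ, u ∉ τ := by
      by_contra! hcon
      have := Finset.card_le_card (show σ ⊆ τ from hcon)
      omega
    have hσeq : insert u τ = σ := Finset.eq_of_subset_of_card_le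
      (Finset.insert_subset huσ hτσ) (by rw [Finset.card_insert_of_notMem huτ]; omega)
    have hIP' : I ⊆ insert σ P := hIP.trans (Finset.subset_insert _ _)
    have hPT' : insert σ P ⊆ T := Finset.insert_subset hσT hPT
    have hk' : (insert σ P).card + k = T.card := by
      rw [Finset.card_insert_of_notMem hσP]; omega
    have hexc := lightExcess_insert (d := d) (H := H) hσP
    have hl := card_lightFacets_le (H := H) hσc
    have hopen_sub : openTangled d H (insert σ P) ⊆ openTangled d H P := by
      intro ρ hρ
      rw [openTangled, Finset.mem_filter] at hρ ⊢
      refine ⟨hρ.1, hρ.2.1, fun h => hρ.2.2 ?_⟩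
      obtain ⟨σ₁, h₁, σ₂, h₂, h₃⟩ := h
      exact ⟨σ₁, Finset.mem_insert_of_mem h₁, σ₂, Finset.mem_insert_of_mem h₂, h₃⟩
    have hopen := Finset.card_le_card hopen_sub
    push_cast at hs
    have hfree : ∀ s' : ℤ, T ∈ explore d H b k s'.toNat (insert σ P) →
        T ∈ Finset.univ.biUnion fun u => explore d H b k s'.toNat (insert (insert u τ) P) :=
      fun s' h => Finset.mem_biUnion.2 ⟨u, Finset.mem_univ _, by rwa [hσeq]⟩
    by_cases hu : u ∈ savingVertices H P τ
    · refine Finset.mem_union_right _ (Finset.mem_biUnion.2 ⟨u, ?_, ?_⟩)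
      · rwa [if_pos (hsav P hPT τ hτc)]
      · have : s.toNat - 1 = (s - 1).toNat := by omega
        rw [hσeq, this]
        refine ih (insert σ P) (s - 1) hIP' hPT' hk' ?_
        rw [hexc]
        have h₁ : (0 : ℤ) ≤
            ((lightFacets d H σ \ P.biUnion (lightFacets d H)).card : ℤ) := by positivity
        zify at hl hopen
        nlinarith
    · refine Finset.mem_union_left _ (hfree s (ih (insert σ P) s hIP' hPT' hk' ?_))
      rw [hexc]
      by_cases htan : IsTangled H τ
      · have hlt : (openTangled d H (insert σ P)).card < (openTangled d H P).card := by
          refine Finset.card_lt_card (Finset.ssubset_iff_of_subset hopen_sub |>.2 ⟨τ, ?_, ?_⟩)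
          · rw [openTangled, Finset.mem_filter]
            refine ⟨Finset.mem_univ _, ⟨hτc, htan⟩, ?_⟩
            rintro ⟨σ₁, h₁, σ₂, h₂, hne, h₃, h₄⟩
            exact hne ((huniq σ₁ h₁ h₃).trans (huniq σ₂ h₂ h₄).symm)
          · rw [openTangled, Finset.mem_filter]
            rintro ⟨-, -, h⟩
            exact h ⟨σ, Finset.mem_insert_self _ _, σ₀, Finset.mem_insert_of_mem hσ₀, hσne,
              hτσ, hτσ₀⟩
        have h₁ : (0 : ℤ) ≤
            ((lightFacets d H σ \ P.biUnion (lightFacets d H)).card : ℤ) := by positivity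
        zify at hl hlt
        nlinarith
      · have h₁ := card_lightFacets_lt hd h₀ hτc htan huτ hu
        rw [hσeq] at h₁
        have h₂ : (lightFacets d H σ \ P.shadow).card ≤
            (lightFacets d H σ \ P.biUnion (lightFacets d H)).card :=
          Finset.card_le_card (Finset.sdiff_subset_sdiff subset_rfl
            (biUnion_lightFacets_subset hPc))
        zify at h₁ h₂ hopen
        nlinarith

end Explore

/-! ### Counting minimal bad cores -/

section Count

variable {V : Type*} [Fintype V] [DecidableEq V] {d : ℕ}

theorem card_powerset_filter_card_le {α : Type*} [DecidableEq α] (S : Finset α) (h : ℕ) :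
    (S.powerset.filter fun t => t.card ≤ h).card ≤ (S.card + 1) ^ h := by
  induction h with
  | zero =>
    rw [pow_zero]
    refine Finset.card_le_one.2 fun t ht t' ht' => ?_
    rw [Finset.mem_filter, Nat.le_zero, Finset.card_eq_zero] at ht ht'
    rw [ht.2, ht'.2]
  | succ h ih =>
    have hsub : (S.powerset.filter fun t => t.card ≤ h + 1) ⊆
        (S.insertNone ×ˢ S.powerset.filter fun t => t.card ≤ h).image
          fun p => p.1.elim p.2 (insert · p.2) := by
      intro t ht
      rw [Finset.mem_filter, Finset.mem_powerset] at ht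
      rw [Finset.mem_image]
      rcases t.eq_empty_or_nonempty with rfl | ⟨a, ha⟩
      · exact ⟨(none, ∅), by simp, rfl⟩
      · refine ⟨(some a, t.erase a), ?_, Finset.insert_erase ha⟩
        rw [Finset.mem_product, Finset.mem_filter, Finset.mem_powerset]
        refine ⟨by simpa using ht.1 ha, (Finset.erase_subset _ _).trans ht.1, ?_⟩
        rw [Finset.card_erase_of_mem ha]
        omega
    calc _ ≤ _ := Finset.card_le_card hsub
      _ ≤ _ := Finset.card_image_le
      _ ≤ (S.card + 1) * (S.card + 1) ^ h := by
        rw [Finset.card_product, Finset.card_insertNone]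
        exact Nat.mul_le_mul_left _ ih
      _ = (S.card + 1) ^ (h + 1) := by rw [pow_succ']

open scoped Classical in
/-- The minimal bad cores with `m` members on the vertex set `V`. -/
noncomputable def badCores (V : Type*) [Fintype V] (d m : ℕ) :
    Finset (Finset (Finset V)) :=
  {T | IsMinimalBadCore d T ∧ T.card = m}

open scoped Classical in
theorem mem_badCores {V : Type*} [Fintype V] {d m : ℕ} {T : Finset (Finset V)} :
    T ∈ badCores V d m ↔ IsMinimalBadCore d T ∧ T.card = m := by
  simp [badCores]

/-- A bound that is useful for small `m`: a minimal bad core consists of subsets of a vertex set with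
at most `(1 - 1 / q) m` elements, where `q = 2 (d + 1) (d + 2)`. -/
theorem card_badCores_le_of_card_vertices (hd : 2 ≤ d) (m : ℕ) :
    (badCores V d m).card ≤ (Fintype.card V + 1) ^
      ((2 * (d + 1) * (d + 2) * m - m) / (2 * (d + 1) * (d + 2))) * (m ^ (d + 1)) ^ m := by
  set q := 2 * (d + 1) * (d + 2) with hq
  have hq₀ : 0 < q := by positivity
  have hw : (q * m - m) / q ≤ m := by
    rw [Nat.div_le_iff_le_mul_add_pred hq₀]; omega
  have hsub : badCores V d m ⊆
      ((Finset.univ : Finset V).powerset.filter fun W => W.card ≤ (q * m - m) / q).biUnion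
        fun W => (W.powersetCard (d + 1)).powersetCard m := by
    intro T hT
    rw [mem_badCores] at hT
    obtain ⟨hT, hTm⟩ := hT
    refine Finset.mem_biUnion.2 ⟨T.biUnion id, ?_, ?_⟩
    · rw [Finset.mem_filter, Finset.mem_powerset, Nat.le_div_iff_mul_le hq₀]
      have := hT.card_vertices_le hd
      rw [hTm, ← hq] at this
      refine ⟨Finset.subset_univ _, ?_⟩
      rw [mul_comm]
      omega
    · refine Finset.mem_powersetCard.2 ⟨fun σ hσ => ?_, hTm⟩
      exact Finset.mem_powersetCard.2
        ⟨Finset.subset_biUnion_of_mem id hσ, (hT.isCore σ hσ).1⟩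
  calc _ ≤ _ := Finset.card_le_card hsub
    _ ≤ _ := Finset.card_biUnion_le_card_mul _ _ ((m ^ (d + 1)) ^ m) fun W hW => ?_
    _ ≤ _ := Nat.mul_le_mul_right _ (card_powerset_filter_card_le _ _)
  rw [Finset.card_powersetCard, Finset.card_powersetCard]
  refine (Nat.choose_le_pow _ _).trans (Nat.pow_le_pow_left ?_ _)
  refine (Nat.choose_le_pow _ _).trans (Nat.pow_le_pow_left ?_ _)
  exact (Finset.mem_filter.1 hW).2.trans hw

variable [Nonempty V]

/-- A minimal bad core that is not too large is reached from one of its seeds by an exploration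
with many saving steps. -/
theorem IsMinimalBadCore.exists_mem_explore (hd : 2 ≤ d) {T : Finset (Finset V)}
    (hT : IsMinimalBadCore d T) {ε : ℝ} (hε : 0 < ε) (hε₁ : ε ≤ 1) {s : ℕ}
    (hsmall : d ^ (d - 1) * (d * ((d + 1) * T.card)) <
      ε ^ (2 ^ d - 1) * (Fintype.card V : ℝ) ^ d)
    (hs : (d + 2) * (d * (2 ^ d * d ^ d * ε * (d * ((d + 1) * T.card)))) + (d + 2) * s +
      (d + 2) * (d + 3) ≤ (T.card : ℝ)) :
    ∃ I ⊆ T, I.card ≤ d + 3 ∧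
      T ∈ explore d (IsHeavy ε (heavyBase ε T)) (2 ^ d * ε * Fintype.card V) (T.card - I.card)
        s I := by
  classical
  obtain ⟨I, hIT, hIc, hI⟩ := hT.exists_seed (by omega)
  refine ⟨I, hIT, hIc, ?_⟩
  have hTc : ∀ σ ∈ T, σ.card = d + 1 := fun σ hσ => (hT.isCore σ hσ).1
  have hcard := Finset.card_le_card hIT
  have htan : ((openTangled d (IsHeavy ε (heavyBase ε T)) I).card : ℝ) ≤
      d * (2 ^ d * d ^ d * ε * (d * ((d + 1) * T.card))) := by
    refine le_trans (Nat.cast_le.2 (Finset.card_le_card fun τ hτ => ?_))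
      (card_isTangled_le hε hε₁ (fun A => card_of_mem_heavyBase hε hTc)
        (card_heavyBase_mul_le hTc))
    rw [openTangled, Finset.mem_filter] at hτ
    exact Finset.mem_filter.2 ⟨hτ.1, hτ.2.1⟩
  have := mem_explore hd (H := IsHeavy ε (heavyBase ε T))
    (not_isHeavy_empty hε (by omega) hTc hsmall) (b := 2 ^ d * ε * Fintype.card V) hT.isCore hI
    (fun P hPT τ hτ => by
      rw [mul_assoc]; exact card_savingVertices_le hε hε₁ hTc hPT hτ)
    (T.card - I.card) I s subset_rfl hIT (by omega) ?_
  · simpa using this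
  · have h₁ := lightExcess_le (d := d) (H := IsHeavy ε (heavyBase ε T))
      fun σ hσ => hTc σ (hIT hσ)
    have h₂ := hT.isCore.lightExcess_nonneg (IsHeavy ε (heavyBase ε T))
    have h₃ : (d + 2) * s + (d + 2) * (openTangled d (IsHeavy ε (heavyBase ε T)) I).card +
        (d + 2) * (d + 3) ≤ T.card := by
      have h₄ : ((d : ℝ) + 2) * (openTangled d (IsHeavy ε (heavyBase ε T)) I).card ≤
          (d + 2) * (d * (2 ^ d * d ^ d * ε * (d * ((d + 1) * T.card)))) := by gcongr
      have h₅ : ((d : ℝ) + 2) * s + (d + 2) *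
          (openTangled d (IsHeavy ε (heavyBase ε T)) I).card + (d + 2) * (d + 3) ≤ T.card := by
        linarith
      exact_mod_cast h₅
    have h₆ : (d + 2) * I.card ≤ (d + 2) * (d + 3) := Nat.mul_le_mul_left _ hIc
    zify at h₃ h₆
    push_cast [hcard]
    linarith

/-- A bound that is useful for large `m`: by `IsMinimalBadCore.exists_mem_explore`, a minimal
bad core is determined by a small family of heavy sets, a seed and an exploration. -/
theorem card_badCores_le_of_explore (hd : 2 ≤ d) {ε : ℝ} (hε : 0 < ε)
    (hε₁ : 2 ^ d * ε ≤ 1) {m s h : ℕ}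
    (hsmall : d ^ (d - 1) * (d * ((d + 1) * m)) < ε ^ (2 ^ d - 1) * (Fintype.card V : ℝ) ^ d)
    (hs : (d + 2) * (d * (2 ^ d * d ^ d * ε * (d * ((d + 1) * m)))) + (d + 2) * s +
      (d + 2) * (d + 3) ≤ (m : ℝ))
    (hh : d * ((d + 1) * m) < (h + 1) * (ε * Fintype.card V)) :
    ((badCores V d m).card : ℝ) ≤ ((Fintype.card V : ℝ) ^ (d - 1) + 1) ^ h *
      (((Fintype.card V : ℝ) ^ (d + 1) + 1) ^ (d + 3) *
        ((2 * Fintype.card V) ^ m * (2 ^ d * ε) ^ s)) := by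
  classical
  set N := Fintype.card V with hN
  have hN₁ : (1 : ℝ) ≤ N := by exact_mod_cast Nat.one_le_iff_ne_zero.2 Fintype.card_ne_zero
  have hε₂ : ε ≤ 1 := by
    have : (1 : ℝ) ≤ 2 ^ d := one_le_pow₀ (by norm_num)
    nlinarith
  have hsub : badCores V d m ⊆
      (((Finset.univ : Finset V).powersetCard (d - 1)).powerset.filter
        fun X => X.card ≤ h).biUnion fun X =>
      (((Finset.univ : Finset V).powersetCard (d + 1)).powerset.filter
        fun I => I.card ≤ d + 3).biUnion fun I =>
      explore d (IsHeavy ε X) (2 ^ d * ε * N) (m - I.card) s I := by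
    intro T hT
    rw [mem_badCores] at hT
    obtain ⟨hT, rfl⟩ := hT
    have hTc : ∀ σ ∈ T, σ.card = d + 1 := fun σ hσ => (hT.isCore σ hσ).1
    obtain ⟨I, hIT, hIc, hmem⟩ := hT.exists_mem_explore hd hε hε₂ hsmall hs
    refine Finset.mem_biUnion.2 ⟨heavyBase ε T, ?_, Finset.mem_biUnion.2 ⟨I, ?_, hmem⟩⟩
    · rw [Finset.mem_filter, Finset.mem_powerset]
      refine ⟨fun A hA => ?_, ?_⟩
      · have := card_of_mem_heavyBase hε hTc hA
        exact Finset.mem_powersetCard.2 ⟨Finset.subset_univ _, by omega⟩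
      · have h₁ := (card_heavyBase_mul_le (ε := ε) hTc).trans_lt hh
        have h₂ : ((heavyBase ε T).card : ℝ) < h + 1 :=
          lt_of_mul_lt_mul_right h₁ (by positivity)
        have h₃ : (heavyBase ε T).card < h + 1 := by exact_mod_cast h₂
        omega
    · rw [Finset.mem_filter, Finset.mem_powerset]
      exact ⟨fun σ hσ => Finset.mem_powersetCard.2 ⟨Finset.subset_univ _, hTc σ (hIT hσ)⟩, hIc⟩
  have hbound : ∀ (S : Finset (Finset (Finset V))) (f : Finset (Finset V) →
      Finset (Finset (Finset V))) (c b : ℝ), 0 ≤ c → (S.card : ℝ) ≤ b →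
      (∀ u ∈ S, ((f u).card : ℝ) ≤ c) → ((S.biUnion f).card : ℝ) ≤ b * c := by
    intro S f c b hc hb h
    calc ((S.biUnion f).card : ℝ) ≤ ∑ u ∈ S, ((f u).card : ℝ) := by
          exact_mod_cast Finset.card_biUnion_le
      _ ≤ S.card * c := by
          rw [← nsmul_eq_mul]; exact Finset.sum_le_card_nsmul _ _ _ h
      _ ≤ b * c := by gcongr
  have hsets : ∀ r l : ℕ, ((((Finset.univ : Finset V).powersetCard r).powerset.filter
      fun X => X.card ≤ l).card : ℝ) ≤ ((N : ℝ) ^ r + 1) ^ l := by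
    intro r l
    have h₁ := card_powerset_filter_card_le ((Finset.univ : Finset V).powersetCard r) l
    have h₂ : ((Finset.univ : Finset V).powersetCard r).card ≤ N ^ r := by
      rw [Finset.card_powersetCard, Finset.card_univ]
      exact Nat.choose_le_pow _ _
    calc _ ≤ ((((((Finset.univ : Finset V).powersetCard r).card + 1) ^ l : ℕ)) : ℝ) :=
          Nat.cast_le.2 h₁
      _ ≤ (((N ^ r + 1) ^ l : ℕ) : ℝ) := Nat.cast_le.2 (Nat.pow_le_pow_left (by omega) _)
      _ = _ := by push_cast; rfl
  refine le_trans (Nat.cast_le.2 (Finset.card_le_card hsub)) ?_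
  refine hbound _ _ _ _ (by positivity) (hsets _ _) fun X _ => ?_
  refine hbound _ _ _ _ (by positivity) (hsets _ _) fun I _ => ?_
  refine (card_explore_le _ (by positivity) hε₁ _ _ _).trans ?_
  gcongr
  · linarith
  · omega

end Count

/-! ### First moment -/

section Probability

open MeasureTheory

/-- A binomial random set contains a given finite set `t` with probability at most `p ^ |t|`. -/
theorem setBernoulli_superset_le {ι : Type*} (u : Set ι) (p : unitInterval) (t : Finset ι) :
    setBernoulli u p {S | (t : Set ι) ⊆ S} ≤ ENNReal.ofReal p ^ t.card := by
  rw [setBernoulli_apply']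
  have : (fun f : ι → Prop => {i | f i}) ⁻¹' {S | (t : Set ι) ⊆ S} =
      Set.pi t fun _ => ({True} : Set Prop) := by
    ext f
    simp [Set.subset_def, Set.mem_pi]
  rw [this]
  refine (Measure.infinitePi_pi _ fun _ _ => .of_discrete).trans_le ?_
  refine Finset.prod_le_pow_card _ _ _ fun i _ => ?_
  have hp : ENNReal.ofReal (p : ℝ) = (unitInterval.toNNReal p : ENNReal) :=
    ENNReal.ofReal_eq_coe_nnreal p.2.1
  rw [hp]
  have h₀ : Measure.dirac False ({True} : Set Prop) = 0 := by
    rw [Measure.dirac_apply' _ .of_discrete]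
    simp
  rw [Measure.add_apply, Measure.smul_apply, Measure.smul_apply, h₀, smul_zero, add_zero,
    ENNReal.smul_def, smul_eq_mul]
  exact mul_le_of_le_one_right' prob_le_one

theorem coe_edgeProb_le {c : ℝ} (hc : 0 < c) (n : ℕ) : (edgeProb c n : ℝ) ≤ c / n := by
  rw [edgeProb, Set.coe_projIcc]
  exact max_le (by positivity) (min_le_right _ _)

/-- The union bound over all minimal bad cores with at most `a` members. -/
theorem one_le_prob_add {d n : ℕ} (hd : 1 ≤ d) {c a : ℝ} (hc : 0 < c) :
    1 ≤ prob d n (edgeProb c n) (fun Y => ∀ R, IsFullCollapse d Y R →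
        IsGravel d R ∨ a < (faceNumber d R : ℝ)) +
      ENNReal.ofReal (∑ m ∈ Finset.Icc 1 ⌊a⌋₊, (badCores (Fin n) d m).card * (c / n) ^ m) := by
  classical
  set μ := setBernoulli {σ : Finset (Fin n) | σ.card = d + 1} (edgeProb c n) with hμ
  set E : Set (Set (Finset (Fin n))) := {S | ∀ R, IsFullCollapse d (complexOf d S) R →
        IsGravel d R ∨ a < (faceNumber d R : ℝ)} with hE
  have hsub : Eᶜ ⊆ ⋃ m ∈ Finset.Icc 1 ⌊a⌋₊, ⋃ T ∈ badCores (Fin n) d m,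
      {S | (T : Set (Finset (Fin n))) ⊆ S} := by
    intro S hS
    rw [Set.mem_compl_iff, hE, Set.mem_ofPred_eq] at hS
    push Not at hS
    obtain ⟨R, hR, hg, hle⟩ := hS
    obtain ⟨T, hT, hTR, hTS⟩ := exists_isMinimalBadCore_of_isFullCollapse hd hR hg
    simp only [Set.mem_iUnion]
    refine ⟨T.card, Finset.mem_Icc.2 ⟨hT.nonempty.card_pos, Nat.le_floor ?_⟩, T,
      mem_badCores.2 ⟨hT, rfl⟩, hTS⟩
    exact le_trans (Nat.cast_le.2 hTR) hle
  have hcompl : μ Eᶜ ≤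
      ENNReal.ofReal (∑ m ∈ Finset.Icc 1 ⌊a⌋₊, (badCores (Fin n) d m).card * (c / n) ^ m) := by
    refine (measure_mono hsub).trans ((measure_biUnion_finset_le _ _).trans ?_)
    rw [ENNReal.ofReal_sum_of_nonneg (fun m _ => by positivity)]
    refine Finset.sum_le_sum fun m _ => (measure_biUnion_finset_le _ _).trans ?_
    rw [ENNReal.ofReal_mul (by positivity), ENNReal.ofReal_natCast, ← nsmul_eq_mul,
      ENNReal.ofReal_pow (by positivity)]
    refine Finset.sum_le_card_nsmul _ _ _ fun T hT => ?_
    refine (setBernoulli_superset_le _ _ _).trans ?_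
    rw [(mem_badCores.1 hT).2]
    gcongr
    exact coe_edgeProb_le hc n
  calc (1 : ENNReal) = μ Set.univ := measure_univ.symm
    _ = μ (E ∪ Eᶜ) := by rw [Set.union_compl_self]
    _ ≤ μ E + μ Eᶜ := measure_union_le _ _
    _ ≤ _ := add_le_add le_rfl hcompl

end Probability

/-! ### Asymptotics -/

section Asymptotics

variable {d : ℕ}

/-- The expected number of minimal bad cores with `m` members, for `m` up to a bound `M` that grows
slowly with `n`. -/
theorem card_badCores_mul_le_of_le (hd : 2 ≤ d) {c : ℝ} (hc : 0 < c) {n m M : ℕ} (hn : 1 ≤ n)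
    (hm : m ≤ M) : (badCores (Fin n) d m).card * (c / n) ^ m ≤
      (2 * c * M ^ (d + 1) * (n : ℝ) ^ (-(1 / (2 * (d + 1) * (d + 2)) : ℝ))) ^ m := by
  have hn₀ : (0 : ℝ) < n := by exact_mod_cast hn
  have hn₁ : (1 : ℝ) ≤ n := by exact_mod_cast hn
  have h := card_badCores_le_of_card_vertices (V := Fin n) hd m
  rw [Fintype.card_fin] at h
  set q : ℕ := 2 * (d + 1) * (d + 2) with hq
  have hq₀ : 0 < q := by positivity
  have hqr : (q : ℝ) = 2 * (d + 1) * (d + 2) := by rw [hq]; push_cast; ring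
  rw [← hqr]
  have hq₀' : (0 : ℝ) < q := by exact_mod_cast hq₀
  set w := (q * m - m) / q with hw
  have hwq : w * q + m ≤ q * m := by
    have h₁ : w * q ≤ q * m - m := Nat.div_mul_le_self _ _
    have h₂ : m ≤ q * m := Nat.le_mul_of_pos_left _ hq₀
    omega
  have hwm : w ≤ m := by nlinarith
  have hwr : (w : ℝ) ≤ m * (1 - 1 / q) := by
    have h₁ : (w : ℝ) * q + m ≤ q * m := by exact_mod_cast hwq
    have h₂ : (m : ℝ) * (1 - 1 / q) = (q * m - m) / q := by field_simp
    rw [h₂, le_div_iff₀ hq₀']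
    linarith
  have hpow : (n : ℝ) ^ w ≤ ((n : ℝ) ^ (1 - 1 / q : ℝ)) ^ m := by
    rw [← Real.rpow_natCast, ← Real.rpow_mul_natCast hn₀.le]
    exact Real.rpow_le_rpow_of_exponent_le hn₁ (by linarith)
  have hsplit : (n : ℝ) ^ (1 - 1 / q : ℝ) = n * (n : ℝ) ^ (-(1 / q : ℝ)) := by
    rw [sub_eq_add_neg, Real.rpow_add hn₀, Real.rpow_one]
  calc ((badCores (Fin n) d m).card : ℝ) * (c / n) ^ m
      ≤ (((n : ℝ) + 1) ^ w * ((m : ℝ) ^ (d + 1)) ^ m) * (c / n) ^ m := by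
        gcongr
        exact_mod_cast h
    _ ≤ ((2 * n : ℝ) ^ w * ((M : ℝ) ^ (d + 1)) ^ m) * (c / n) ^ m := by
        gcongr
        linarith
    _ ≤ ((2 ^ m * (n * (n : ℝ) ^ (-(1 / q : ℝ))) ^ m) * ((M : ℝ) ^ (d + 1)) ^ m) *
          (c / n) ^ m := by
        rw [mul_pow 2 (n : ℝ) w, ← hsplit]
        gcongr
        norm_num
    _ = (2 * c * M ^ (d + 1) * (n : ℝ) ^ (-(1 / q : ℝ))) ^ m := by
        rw [← mul_pow, ← mul_pow, ← mul_pow]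
        congr 1
        field_simp

/-- The expected number of minimal bad cores with `m` members, for `m` bounded from below. The
hypotheses on `η` and `ε` make the gain from the saving steps outweigh the factors that are
exponential in `m`, and the hypothesis on `l`, a bound for `log₂ n`, allows to list the heavy sets
at a cost of `2 ^ m`. -/
theorem card_badCores_mul_le_of_ge (hd : 2 ≤ d) {c η ε α : ℝ} (hc : 0 < c) (hη : 0 < η)
    (hη₁ : η ≤ 1) (hηc : 16 * c * η ≤ 1) (hε : 0 < ε) (hεη : 2 ^ d * ε ≤ η ^ (2 * (d + 2)))
    (hεd : 4 * ((d + 2) * (d * (2 ^ d * d ^ d * ε * (d * (d + 1))))) ≤ (1 : ℝ))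
    (hα : d ^ (d - 1) * (d * (d + 1)) * α < ε ^ (2 ^ d - 1)) {n m l : ℕ}
    (hn : 2 ≤ n) (hnl : n ≤ 2 ^ l) (hl : l * (d * (d * (d + 1))) ≤ ε * n)
    (hm : 4 * (d + 2) * (d + 4) ≤ m) (hmα : m ≤ α * (n : ℝ) ^ d) :
    (badCores (Fin n) d m).card * (c / n) ^ m ≤
      ((n : ℝ) ^ (d + 1) + 1) ^ (d + 3) * (1 / 4) ^ m := by
  have hn₀ : (0 : ℝ) < n := by positivity
  have hn₂ : (2 : ℝ) ≤ n := by exact_mod_cast hn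
  have : Nonempty (Fin n) := ⟨⟨0, by omega⟩⟩
  have hηp : η ^ (2 * (d + 2)) ≤ 1 := pow_le_one₀ hη.le hη₁
  set s := m / (2 * (d + 2)) + 1 with hs
  set h := ⌊(d * ((d + 1) * m) : ℝ) / (ε * n)⌋₊ with hh
  have hs₁ : m ≤ 2 * (d + 2) * s := by
    have := Nat.lt_mul_div_succ m (show 0 < 2 * (d + 2) by positivity)
    rw [hs]
    exact this.le
  have hs₂ : 2 * ((d + 2) * s) ≤ m + 2 * (d + 2) := by
    have := Nat.mul_div_le m (2 * (d + 2))
    rw [hs]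
    nlinarith
  have hεn : 0 < ε * n := by positivity
  have key := card_badCores_le_of_explore (V := Fin n) (d := d) (m := m) (s := s) (h := h) hd hε
    (hεη.trans hηp) ?_ ?_ ?_
  · rw [Fintype.card_fin] at key
    have hh₁ : l * (d * h) ≤ m := by
      have h₁ : (h : ℝ) ≤ (d * ((d + 1) * m) : ℝ) / (ε * n) := Nat.floor_le (by positivity)
      have h₂ : (h : ℝ) * (ε * n) ≤ d * ((d + 1) * m) := by rwa [le_div_iff₀ hεn] at h₁
      have h₃ : (l * (d * h) : ℝ) * (ε * n) ≤ m * (ε * n) := by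
        calc (l * (d * h) : ℝ) * (ε * n) = l * d * (h * (ε * n)) := by ring
          _ ≤ l * d * (d * ((d + 1) * m)) := by gcongr
          _ = m * (l * (d * (d * (d + 1)))) := by ring
          _ ≤ m * (ε * n) := by gcongr
      exact_mod_cast le_of_mul_le_mul_right h₃ hεn
    have hX : ((n : ℝ) ^ (d - 1) + 1) ^ h ≤ 2 ^ m := by
      have h₁ : (n : ℝ) ^ (d - 1) + 1 ≤ (n : ℝ) ^ d := by
        obtain ⟨e, rfl⟩ : ∃ e, d = e + 1 := ⟨d - 1, by omega⟩
        have : (1 : ℝ) ≤ (n : ℝ) ^ e := one_le_pow₀ (by linarith)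
        rw [Nat.add_sub_cancel, pow_succ]
        nlinarith
      have h₂ : (n : ℝ) ≤ 2 ^ l := by exact_mod_cast hnl
      calc ((n : ℝ) ^ (d - 1) + 1) ^ h ≤ ((n : ℝ) ^ d) ^ h := by gcongr
        _ ≤ (((2 : ℝ) ^ l) ^ d) ^ h := by gcongr
        _ = 2 ^ (l * (d * h)) := by rw [← pow_mul, ← pow_mul]
        _ ≤ 2 ^ m := pow_le_pow_right₀ (by norm_num) hh₁
    have hδ : (2 ^ d * ε) ^ s ≤ η ^ m := by
      calc (2 ^ d * ε) ^ s ≤ (η ^ (2 * (d + 2))) ^ s := by gcongr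
        _ = η ^ (2 * (d + 2) * s) := by rw [← pow_mul]
        _ ≤ η ^ m := pow_le_pow_of_le_one hη.le hη₁ hs₁
    calc ((badCores (Fin n) d m).card : ℝ) * (c / n) ^ m
        ≤ (((n : ℝ) ^ (d - 1) + 1) ^ h * (((n : ℝ) ^ (d + 1) + 1) ^ (d + 3) *
          ((2 * n) ^ m * (2 ^ d * ε) ^ s))) * (c / n) ^ m := by gcongr
      _ ≤ (2 ^ m * (((n : ℝ) ^ (d + 1) + 1) ^ (d + 3) *
          ((2 * n) ^ m * η ^ m))) * (c / n) ^ m := by gcongr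
      _ = ((n : ℝ) ^ (d + 1) + 1) ^ (d + 3) * (2 * (2 * n) * η * (c / n)) ^ m := by
          simp only [mul_pow]; ring
      _ ≤ ((n : ℝ) ^ (d + 1) + 1) ^ (d + 3) * (1 / 4) ^ m := by
          gcongr
          have : 2 * (2 * n) * η * (c / n) = 4 * c * η := by field_simp; ring
          rw [this]
          linarith
  · rw [Fintype.card_fin]
    calc (d ^ (d - 1) * (d * ((d + 1) * m)) : ℝ) = d ^ (d - 1) * (d * (d + 1)) * m := by ring
      _ ≤ d ^ (d - 1) * (d * (d + 1)) * (α * (n : ℝ) ^ d) := by gcongr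
      _ = d ^ (d - 1) * (d * (d + 1)) * α * (n : ℝ) ^ d := by ring
      _ < ε ^ (2 ^ d - 1) * (n : ℝ) ^ d := by gcongr
  · have h₁ : (d + 2) * (d * (2 ^ d * d ^ d * ε * (d * ((d + 1) * m)))) ≤ (m : ℝ) / 4 := by
      have : (0 : ℝ) ≤ m := by positivity
      nlinarith [mul_le_mul_of_nonneg_right hεd this]
    have h₂ : (2 * ((d + 2) * s) : ℝ) ≤ m + 2 * (d + 2) := by exact_mod_cast hs₂
    have h₃ : (4 * (d + 2) * (d + 4) : ℝ) ≤ m := by exact_mod_cast hm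
    linarith
  · rw [Fintype.card_fin, ← div_lt_iff₀ hεn]
    exact Nat.lt_floor_add_one _

/-- The constants of `card_badCores_mul_le_of_ge`. -/
theorem exists_constants (hd : 2 ≤ d) {c : ℝ} (hc : 0 < c) :
    ∃ η ε α : ℝ, 0 < η ∧ η ≤ 1 ∧ 16 * c * η ≤ 1 ∧ 0 < ε ∧ 2 ^ d * ε ≤ η ^ (2 * (d + 2)) ∧
      4 * ((d + 2) * (d * (2 ^ d * d ^ d * ε * (d * (d + 1))))) ≤ (1 : ℝ) ∧ 0 < α ∧
      d ^ (d - 1) * (d * (d + 1)) * α < ε ^ (2 ^ d - 1) := by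
  have hd₀ : (0 : ℝ) < d := by positivity
  set η : ℝ := min 1 (1 / (16 * c)) with hη
  have hη₀ : 0 < η := lt_min one_pos (by positivity)
  have hηc : 16 * c * η ≤ 1 := by
    have := min_le_right 1 (1 / (16 * c))
    calc 16 * c * η ≤ 16 * c * (1 / (16 * c)) := by gcongr
      _ = 1 := by field_simp
  set ε : ℝ := min (η ^ (2 * (d + 2)) / 2 ^ d)
    (1 / (4 * ((d + 2) * (d * (2 ^ d * d ^ d * (d * (d + 1))))))) with hε
  have hε₀ : 0 < ε := lt_min (by positivity) (by positivity)
  have hεη : 2 ^ d * ε ≤ η ^ (2 * (d + 2)) := by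
    have : ε ≤ η ^ (2 * (d + 2)) / 2 ^ d := min_le_left _ _
    rwa [le_div_iff₀' (by positivity)] at this
  have hεd : 4 * ((d + 2) * (d * (2 ^ d * d ^ d * ε * (d * (d + 1))))) ≤ (1 : ℝ) := by
    have : ε ≤ 1 / (4 * ((d + 2) * (d * (2 ^ d * d ^ d * (d * (d + 1)))))) := min_le_right _ _
    rw [le_div_iff₀' (by positivity)] at this
    linarith
  set α : ℝ := ε ^ (2 ^ d - 1) / (2 * (d ^ (d - 1) * (d * (d + 1)))) with hα
  have hα₀ : 0 < α := by positivity
  have hα₁ : d ^ (d - 1) * (d * (d + 1)) * α < ε ^ (2 ^ d - 1) := by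
    have h₁ : d ^ (d - 1) * (d * (d + 1)) * α = ε ^ (2 ^ d - 1) / 2 := by rw [hα]; field_simp
    rw [h₁]
    exact half_lt_self (by positivity)
  exact ⟨η, ε, α, hη₀, min_le_left _ _, hηc, hε₀, hεη, hεd, hα₀, hα₁⟩

/-- Powers of `log n` are negligible compared with powers of `n`. -/
theorem tendsto_log_pow_mul_rpow_neg (k : ℕ) {a : ℝ} (ha : 0 < a) :
    Tendsto (fun n : ℕ => ((Nat.log 2 n + 1 : ℕ) : ℝ) ^ k * (n : ℝ) ^ (-a)) atTop (𝓝 0) := by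
  have h₁ : Tendsto (fun n : ℕ => 3 ^ k * (Real.log n ^ (k : ℝ) / (n : ℝ) ^ a)) atTop (𝓝 0) := by
    have := ((isLittleO_log_rpow_rpow_atTop (k : ℝ) ha).tendsto_div_nhds_zero).comp
      tendsto_natCast_atTop_atTop
    simpa using this.const_mul ((3 : ℝ) ^ k)
  refine squeeze_zero' (Eventually.of_forall fun n => by positivity) ?_ h₁
  filter_upwards [eventually_ge_atTop 2] with n hn
  have hn₀ : (0 : ℝ) < n := by positivity
  have hlog2 : (0.6931471803 : ℝ) < Real.log 2 := Real.log_two_gt_d9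
  have hlogn : Real.log 2 ≤ Real.log n := Real.log_le_log (by norm_num) (by exact_mod_cast hn)
  have hle : ((Nat.log 2 n + 1 : ℕ) : ℝ) ≤ 3 * Real.log n := by
    have h₂ : (Nat.log 2 n : ℝ) ≤ Real.logb 2 n := Real.natLog_le_logb n 2
    have h₃ : Real.logb 2 n ≤ 1.5 * Real.log n := by
      rw [Real.logb, div_le_iff₀ (by linarith)]
      nlinarith
    push_cast
    linarith
  rw [Real.rpow_natCast, Real.rpow_neg hn₀.le, ← div_eq_mul_inv, ← mul_div_assoc, ← mul_pow]
  gcongr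

/-- The expected number of minimal bad cores with at most `α n ^ d` members. The parameter `M`
separates the two ranges in which the bounds on the number of cores are used. -/
theorem sum_card_badCores_le (hd : 2 ≤ d) {c η ε α : ℝ} (hc : 0 < c) (hη : 0 < η)
    (hη₁ : η ≤ 1) (hηc : 16 * c * η ≤ 1) (hε : 0 < ε) (hεη : 2 ^ d * ε ≤ η ^ (2 * (d + 2)))
    (hεd : 4 * ((d + 2) * (d * (2 ^ d * d ^ d * ε * (d * (d + 1))))) ≤ (1 : ℝ)) (hα₀ : 0 < α)
    (hα : d ^ (d - 1) * (d * (d + 1)) * α < ε ^ (2 ^ d - 1)) {n l M : ℕ}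
    (hn : 2 ≤ n) (hnl : n ≤ 2 ^ l) (hl : l * (d * (d * (d + 1))) ≤ ε * n)
    (hM : 4 * (d + 2) * (d + 4) ≤ M) {θ : ℝ}
    (hθ : θ = 2 * c * M ^ (d + 1) * (n : ℝ) ^ (-(1 / (2 * (d + 1) * (d + 2)) : ℝ)))
    (hθ₁ : θ ≤ 1) :
    ∑ m ∈ Finset.Icc 1 ⌊α * (n : ℝ) ^ d⌋₊, (badCores (Fin n) d m).card * (c / n) ^ m ≤
      M * θ + ((n : ℝ) ^ (d + 1) + 1) ^ (d + 3) * (1 / 2) ^ M * 2 := by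
  have hθ₀ : 0 ≤ θ := by rw [hθ]; positivity
  set Q : ℝ := ((n : ℝ) ^ (d + 1) + 1) ^ (d + 3) with hQ
  have hQ₀ : 0 ≤ Q := by positivity
  have hterm : ∀ m ∈ Finset.Icc 1 ⌊α * (n : ℝ) ^ d⌋₊,
      (badCores (Fin n) d m).card * (c / n) ^ m ≤
        (if m ∈ Finset.Icc 1 M then θ else 0) + Q * (1 / 2) ^ M * (1 / 2) ^ m := by
    intro m hm
    rw [Finset.mem_Icc] at hm
    by_cases hmM : m ≤ M
    · rw [if_pos (Finset.mem_Icc.2 ⟨hm.1, hmM⟩)]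
      have h₁ := card_badCores_mul_le_of_le hd hc (by omega : 1 ≤ n) hmM
      rw [← hθ] at h₁
      have h₂ : θ ^ m ≤ θ := pow_le_of_le_one hθ₀ hθ₁ (by omega)
      have h₃ : 0 ≤ Q * (1 / 2) ^ M * (1 / 2) ^ m := by positivity
      exact (h₁.trans h₂).trans (le_add_of_nonneg_right h₃)
    · rw [if_neg (fun h => hmM (Finset.mem_Icc.1 h).2), zero_add]
      refine (card_badCores_mul_le_of_ge hd hc hη hη₁ hηc hε hεη hεd hα hn hnl
        hl (by omega) ((Nat.le_floor_iff (by positivity)).1 hm.2)).trans ?_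
      rw [mul_assoc, show (1 / 4 : ℝ) = 1 / 2 * (1 / 2) by norm_num, mul_pow]
      refine mul_le_mul_of_nonneg_left (mul_le_mul_of_nonneg_right ?_ (by positivity)) hQ₀
      exact pow_le_pow_of_le_one (by norm_num) (by norm_num) (by omega)
  have hgeom : ∑ m ∈ Finset.Icc 1 ⌊α * (n : ℝ) ^ d⌋₊, ((1 : ℝ) / 2) ^ m ≤ 2 := by
    refine (summable_geometric_two.sum_le_tsum _ fun i _ => by positivity).trans ?_
    rw [tsum_geometric_two]
  have hfilter : ((Finset.Icc 1 ⌊α * (n : ℝ) ^ d⌋₊).filter (· ∈ Finset.Icc 1 M)).card ≤ M := by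
    calc _ ≤ (Finset.Icc 1 M).card :=
          Finset.card_le_card fun m hm => (Finset.mem_filter.1 hm).2
      _ = M := by simp
  refine (Finset.sum_le_sum hterm).trans ?_
  rw [Finset.sum_add_distrib, ← Finset.mul_sum, ← Finset.sum_filter, Finset.sum_const,
    nsmul_eq_mul]
  exact add_le_add (mul_le_mul_of_nonneg_right (Nat.cast_le.2 hfilter) hθ₀)
    (mul_le_mul_of_nonneg_left hgeom (by positivity))

/-- The expected number of minimal bad cores with at most `α n ^ d` members tends to zero. -/
theorem exists_tendsto_sum_card_badCores (hd : 2 ≤ d) {c : ℝ} (hc : 0 < c) :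
    ∃ α : ℝ, 0 < α ∧ Tendsto (fun n : ℕ => ∑ m ∈ Finset.Icc 1 ⌊α * (n : ℝ) ^ d⌋₊,
      (badCores (Fin n) d m).card * (c / n) ^ m) atTop (𝓝 0) := by
  obtain ⟨η, ε, α, hη₀, hη₁, hηc, hε₀, hεη, hεd, hα₀, hα₁⟩ := exists_constants hd hc
  refine ⟨α, hα₀, ?_⟩
  have hd₀ : (0 : ℝ) < d := by positivity
  obtain ⟨l, hl⟩ : ∃ l : ℕ → ℕ, ∀ n, l n = Nat.log 2 n + 1 := ⟨_, fun _ => rfl⟩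
  -- The bound for the larger `m` is `2 ^ (-m)` times a polynomial in `n` of degree `C - 1`, which
  -- is negligible compared with `2 ^ (C * l n)`.
  obtain ⟨C, hC⟩ : ∃ C, C = (d + 1) * (d + 3) + 1 := ⟨_, rfl⟩
  obtain ⟨a, ha⟩ : ∃ a : ℝ, a = 1 / (2 * (d + 1) * (d + 2)) := ⟨_, rfl⟩
  have ha₀ : 0 < a := by rw [ha]; positivity
  obtain ⟨θ, hθ⟩ : ∃ θ : ℕ → ℝ, ∀ n, θ n =
    2 * c * ((C * l n : ℕ) : ℝ) ^ (d + 1) * (n : ℝ) ^ (-a) := ⟨_, fun _ => rfl⟩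
  have hθ_lim : Tendsto θ atTop (𝓝 0) := by
    have := (tendsto_log_pow_mul_rpow_neg (d + 1) ha₀).const_mul (2 * c * (C : ℝ) ^ (d + 1))
    rw [mul_zero] at this
    refine this.congr fun n => ?_
    rw [hθ, ← hl]
    push_cast
    ring
  have hMθ_lim : Tendsto (fun n => ((C * l n : ℕ) : ℝ) * θ n) atTop (𝓝 0) := by
    have := (tendsto_log_pow_mul_rpow_neg (d + 2) ha₀).const_mul (2 * c * (C : ℝ) ^ (d + 2))
    rw [mul_zero] at this
    refine this.congr fun n => ?_
    rw [hθ, ← hl]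
    push_cast
    ring
  have htail_lim : Tendsto (fun n : ℕ => (2 : ℝ) ^ (d + 4) / n) atTop (𝓝 0) :=
    tendsto_const_div_atTop_nhds_zero_nat _
  have hl_lim : Tendsto (fun n => (l n : ℝ) / n) atTop (𝓝 0) := by
    refine (tendsto_log_pow_mul_rpow_neg 1 one_pos).congr fun n => ?_
    rw [pow_one, Real.rpow_neg_one, div_eq_mul_inv, hl]
  have hl_top : Tendsto l atTop atTop :=
    tendsto_atTop.2 fun b => by
      filter_upwards [eventually_ge_atTop (2 ^ b)] with n hn
      rw [hl]
      exact (Nat.le_log_of_pow_le one_lt_two hn).trans (Nat.le_succ _)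
  have hlim := hMθ_lim.add htail_lim
  rw [add_zero] at hlim
  refine squeeze_zero' (Eventually.of_forall fun n => Finset.sum_nonneg fun m _ => ?_) ?_ hlim
  · exact mul_nonneg (Nat.cast_nonneg _) (pow_nonneg (div_nonneg hc.le (Nat.cast_nonneg _)) _)
  filter_upwards [eventually_ge_atTop 2, hθ_lim.eventually_le_const one_pos,
    hl_lim.eventually_le_const (show 0 < ε / (d * (d * (d + 1))) by positivity),
    hl_top.eventually_ge_atTop (4 * (d + 2) * (d + 4))] with n hn hθn hln hlarge
  have hn₀ : (0 : ℝ) < n := by positivity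
  have hn₁ : (1 : ℝ) ≤ n := by exact_mod_cast (by omega : 1 ≤ n)
  have hnl : n ≤ 2 ^ l n := by rw [hl]; exact (Nat.lt_pow_succ_log_self one_lt_two n).le
  have hlε : l n * (d * (d * (d + 1))) ≤ ε * n := by
    rwa [div_le_div_iff₀ hn₀ (by positivity)] at hln
  have hlM : l n ≤ C * l n := Nat.le_mul_of_pos_left _ (by omega)
  refine (sum_card_badCores_le hd hc hη₀ hη₁ hηc hε₀ hεη hεd hα₀ hα₁ hn hnl hlε
    (hlarge.trans hlM) (by rw [hθ, ha]) hθn).trans (add_le_add le_rfl ?_)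
  have h₁ : ((n : ℝ) ^ (d + 1) + 1) ^ (d + 3) ≤
      2 ^ (d + 3) * (n : ℝ) ^ ((d + 1) * (d + 3)) := by
    rw [pow_mul, ← mul_pow]
    gcongr
    have : (1 : ℝ) ≤ (n : ℝ) ^ (d + 1) := one_le_pow₀ hn₁
    linarith
  have h₂ : (1 / 2 : ℝ) ^ (C * l n) ≤ 1 / (n : ℝ) ^ C := by
    have h₃ : (n : ℝ) ≤ 2 ^ l n := by exact_mod_cast hnl
    rw [one_div_pow]
    refine one_div_le_one_div_of_le (by positivity) ?_
    calc (n : ℝ) ^ C ≤ (2 ^ l n) ^ C := pow_le_pow_left₀ hn₀.le h₃ _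
      _ = 2 ^ (C * l n) := by rw [← pow_mul, mul_comm]
  calc ((n : ℝ) ^ (d + 1) + 1) ^ (d + 3) * (1 / 2) ^ (C * l n) * 2
      ≤ (2 ^ (d + 3) * (n : ℝ) ^ ((d + 1) * (d + 3))) * (1 / (n : ℝ) ^ C) * 2 := by gcongr
    _ = 2 ^ (d + 4) / n := by
        rw [hC, pow_succ (n : ℝ)]
        field_simp
        ring

end Asymptotics

end RandomComplex

theorem mainTheorem3 (d : ℕ) (hd : 2 ≤ d) (c : ℝ) (hc : 0 < c) :
    ∃ α : ℝ, 0 < α ∧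
      Tendsto
        (fun n : ℕ => RandomComplex.prob d n (RandomComplex.edgeProb c n)
          (fun Y => ∀ R, RandomComplex.IsFullCollapse d Y R →
            RandomComplex.IsGravel d R ∨
              α * (n : ℝ) ^ d < (RandomComplex.faceNumber d R : ℝ)))
        atTop (𝓝 1) := by
  obtain ⟨α, hα, hlim⟩ := RandomComplex.exists_tendsto_sum_card_badCores hd hc
  refine ⟨α, hα, ?_⟩
  have h₁ := ENNReal.Tendsto.sub (tendsto_const_nhds (x := (1 : ENNReal)))
    (ENNReal.tendsto_ofReal hlim) (Or.inl ENNReal.one_ne_top)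
  rw [ENNReal.ofReal_zero, tsub_zero] at h₁
  refine tendsto_of_tendsto_of_tendsto_of_le_of_le h₁ tendsto_const_nhds (fun n => ?_)
    (fun n => ?_)
  · exact tsub_le_iff_right.2 (RandomComplex.one_le_prob_add (by omega) hc)
  · exact MeasureTheory.prob_le_one
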